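/- Let $(L,\beta)$ be a positive-definite even lattice: $L$ is a free $\mathbb{Z}$-module of finite rank $\mathrm{rk}$, and $\beta$ is a symmetric $\mathbb{Z}$-valued bilinear form on $L$ with $\beta(x,x)$ even and $\beta(x,x)>0$ for $x\neq 0$. Write $\beta(x)=\tfrac12\beta(x,x)$ and extend $\beta$ to $L\otimes\mathbb{Q}$ and $L\otimes\mathbb{C}$. Let $L^\#=\{y\in L\otimes\mathbb{Q}:\beta(y,x)\in\mathbb{Z}\text{ for all }x\in L\}$ and $e(w)=e^{2\pi i w}$. Let $k$ be an even integer with $k>\frac{\mathrm{rk}}{2}+2$. For $\tau$ in the upper half-plane $\mathfrak{H}$, $z\in L\otimes\mathbb{C}$, $A=\left(\begin{smallmatrix}a&b\\c&d\end{smallmatrix}\right)\in\mathrm{SL}_2(\mathbb{Z})$ and $h=(u,v)\in L\times L$ put $$\phi|_kA(\tau,z)=\phi\Big(A\tau,\frac{z}{c\tau+d}\Big)(c\tau+d)^{-k}e\Big(\frac{-c\beta(z)}{c\tau+d}\Big),\qquad \phi|h(\tau,z)=\phi(\tau,z+u\tau+v)\,e(\tau\beta(u)+\beta(u,z)),$$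 and $\phi|_k(A,h)=(\phi|_kA)|h$. This is a right action of the Jacobi group $J=\mathrm{SL}_2(\mathbb{Z})\ltimes(L\times L)$ with $(A,h)(A',h')=(AA',hA'+h')$, where $(u,v)A'=(a'u+c'v,b'u+d'v)$. Let $\Gamma_\infty=\{\left(\begin{smallmatrix}1&n\\0&1\end{smallmatrix}\right):n\in\mathbb{Z}\}$ and let $J_\infty\subset J$ consist of all $(A,(0,\mu))$ with $A\in\Gamma_\infty$, $\mu\in L$. For $r\in L^\#$ with $\beta(r)\in\mathbb{Z}$ let $g_r(\tau,z)=e(\tau\beta(r)+\beta(r,z))$, and define the Jacobi–Eisenstein series $$E_r=\frac12\sum_{\gamma\in J_\infty\backslash J}g_r|_k\gamma ,$$ where the terms over each element of $\Gamma_\infty\backslash\mathrm{SL}_2(\mathbb{Z})$ are summed first. It depends only on the class of $r$ in $L^\#/L$. For $y\in L^\#/L$ let $$\vartheta_{L,y}(\tau,z)=\sum_{r\in L^\#,\ r\equiv y\bmod L}e(\tau\beta(r)+\beta(r,z)).$$ The series $E_0$ has an absolutely convergent Fourier expansion $E_0(\tau,z)=\sum G_0(D,r)\,e((\beta(r)-D)\tau+\beta(r,z))$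 over all $r\in L^\#$ and $D\in\mathbb{Q}_{\le0}$ with $D\equiv\beta(r)\bmod\mathbb{Z}$, where $G_0(D,r)$ depends only on $D$ and $r\bmod L$. Put $h_{0,y}(\tau)=\sum_{D}G_0(D,y)e(-D\tau)$, the sum over all $D\in\mathbb{Q}_{\le 0}$ with $D\equiv\beta(y)\bmod\mathbb{Z}$. Let $x\in L^\#/L$ be isotropic, i.e. $\beta(x)\in\mathbb{Z}$, and let $N_x$ be its order. Then all these series converge absolutely (the one for $E_r$ in the sense that the sum over each fibre of $J_\infty\backslash J\to\Gamma_\infty\backslash\mathrm{SL}_2(\mathbb{Z})$, and the sum of the results over $\Gamma_\infty\backslash\mathrm{SL}_2(\mathbb{Z})$, are absolutely convergent), and $$\sum_{\lambda\bmod N_x}E_{\lambda x}(\tau,z)=\sum_{\substack{y\in L^\#/L\\ \beta(x,y)\in\mathbb{Z}}}\Big(\sum_{\lambda\bmod N_x}h_{0,y+\lambda x}(\tau)\Big)\vartheta_{L,y}(\tau,z)$$ for all $\tau\in\mathfrak{H}$ and $z\in L\otimes\mathbb{C}$. Equivalently, $\sum_{\lambda\bmod N_x}E_{\lambda x}$ has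 the absolutely convergent Fourier expansion of the above form whose coefficient at $(D,y)$ is $\sum_{\lambda\bmod N_x}G_0(D,y+\lambda x)$ if $\beta(x,y)\in\mathbb{Z}$, and $0$ otherwise. -/

import Mathlib

open scoped UpperHalfPlane TensorProduct MatrixGroups

noncomputable section

namespace LatticeJacobi

/-- A positive-definite even lattice `(L, β)`, where `L` is a free `ℤ`-module of finite rank and
`β` is a symmetric bilinear form with integral values. -/
structure PosDefEvenForm (L : Type*) [AddCommGroup L] where
  /-- The bilinear form `β : L × L → ℤ`. -/
  form : LinearMap.BilinForm ℤ L
  symm : ∀ x y, form x y = form y x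
  even : ∀ x, Even (form x x)
  pos : ∀ x, x ≠ 0 → 0 < form x x

variable {L : Type*} [AddCommGroup L]

/-- The inclusion `L → L ⊗ ℚ`. -/
def inclQ (L : Type*) [AddCommGroup L] : L →+ ℚ ⊗[ℤ] L :=
  (TensorProduct.mk ℤ ℚ L 1).toAddMonoidHom

/-- The inclusion `L → L ⊗ ℂ`. -/
def inclC (L : Type*) [AddCommGroup L] : L →+ ℂ ⊗[ℤ] L :=
  (TensorProduct.mk ℤ ℂ L 1).toAddMonoidHom

/-- The inclusion `L ⊗ ℚ → L ⊗ ℂ`. -/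
def ratToC (L : Type*) [AddCommGroup L] : ℚ ⊗[ℤ] L →+ ℂ ⊗[ℤ] L :=
  (LinearMap.rTensor L (algebraMap ℚ ℂ).toAddMonoidHom.toIntLinearMap).toAddMonoidHom

theorem inclQ_apply (x : L) : inclQ L x = (1 : ℚ) ⊗ₜ[ℤ] x := rfl

theorem inclC_apply (x : L) : inclC L x = (1 : ℂ) ⊗ₜ[ℤ] x := rfl

theorem ratToC_tmul (a : ℚ) (x : L) : ratToC L (a ⊗ₜ[ℤ] x) = (a : ℂ) ⊗ₜ[ℤ] x := rfl

theorem ratToC_incl (x : L) : ratToC L (inclQ L x) = inclC L x := by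
  rw [inclQ_apply, inclC_apply, ratToC_tmul, Rat.cast_one]

/-- `e(w) = exp(2πiw)`. -/
def e (w : ℂ) : ℂ := Complex.exp (2 * Real.pi * Complex.I * w)

theorem e_add (v w : ℂ) : e (v + w) = e v * e w := by
  simp only [e, ← Complex.exp_add]; ring_nf

theorem e_intCast (n : ℤ) : e n = 1 := by
  rw [e, Complex.exp_eq_one_iff]; exact ⟨n, by ring⟩

theorem e_eq_of_sub_int {v w : ℂ} (n : ℤ) (h : v - w = n) : e v = e w := by
  rw [show v = w + n by rw [← h]; ring, e_add, e_intCast, mul_one]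

namespace PosDefEvenForm

variable (B : PosDefEvenForm L)

/-- The extension of `β` to `L ⊗ ℚ`. -/
def bilQ : LinearMap.BilinForm ℚ (ℚ ⊗[ℤ] L) := B.form.baseChange ℚ

/-- The extension of `β` to `L ⊗ ℂ`. -/
def bilC : LinearMap.BilinForm ℂ (ℂ ⊗[ℤ] L) := B.form.baseChange ℂ

/-- The quadratic form `β(v) = β(v, v) / 2` on `L ⊗ ℚ`. -/
def quadQ (v : ℚ ⊗[ℤ] L) : ℚ := B.bilQ v v / 2

/-- The quadratic form `β(z) = β(z, z) / 2` on `L ⊗ ℂ`. -/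
def quadC (z : ℂ ⊗[ℤ] L) : ℂ := B.bilC z z / 2

/-- The dual lattice `L^# = {y ∈ L ⊗ ℚ : β(y, x) ∈ ℤ for all x ∈ L}`. -/
def dual : AddSubgroup (ℚ ⊗[ℤ] L) where
  carrier := {v | ∀ x : L, ∃ n : ℤ, B.bilQ v (inclQ L x) = n}
  add_mem' {v w} hv hw x := by
    obtain ⟨n, hn⟩ := hv x
    obtain ⟨m, hm⟩ := hw x
    exact ⟨n + m, by simp [hn, hm]⟩
  zero_mem' x := ⟨0, by simp⟩
  neg_mem' {v} hv x := by
    obtain ⟨n, hn⟩ := hv x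
    exact ⟨-n, by simp [hn]⟩

/-- `L` as a subgroup of `L^#`. -/
def sub : AddSubgroup B.dual := (inclQ L).range.addSubgroupOf B.dual

/-- The group `L^#/L`. -/
abbrev Disc : Type _ := B.dual ⧸ B.sub

/-- The class in `L^#/L` of an element of `L^#`. -/
abbrev cls (r : B.dual) : B.Disc := QuotientAddGroup.mk r

theorem bilC_symm (v w : ℂ ⊗[ℤ] L) : B.bilC v w = B.bilC w v := by
  induction v using TensorProduct.induction_on with
  | zero => simp
  | add v v' h h' => simp [h, h']
  | tmul a x =>
    induction w using TensorProduct.induction_on with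
    | zero => simp
    | add v v' h h' => simp [h, h']
    | tmul b y =>
      rw [bilC, LinearMap.BilinForm.baseChange_tmul, LinearMap.BilinForm.baseChange_tmul, B.symm,
        mul_comm]

theorem bilQ_symm (v w : ℚ ⊗[ℤ] L) : B.bilQ v w = B.bilQ w v := by
  induction v using TensorProduct.induction_on with
  | zero => simp
  | add v v' h h' => simp [h, h']
  | tmul a x =>
    induction w using TensorProduct.induction_on with
    | zero => simp
    | add v v' h h' => simp [h, h']
    | tmul b y =>
      rw [bilQ, LinearMap.BilinForm.baseChange_tmul, LinearMap.BilinForm.baseChange_tmul, B.symm,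
        mul_comm]

theorem bilQ_incl (x y : L) : B.bilQ (inclQ L x) (inclQ L y) = B.form x y := by
  rw [inclQ_apply, inclQ_apply, bilQ, LinearMap.BilinForm.baseChange_tmul]; simp

theorem bilC_incl (x y : L) : B.bilC (inclC L x) (inclC L y) = B.form x y := by
  rw [inclC_apply, inclC_apply, bilC, LinearMap.BilinForm.baseChange_tmul]; simp

theorem bilC_ratToC (v w : ℚ ⊗[ℤ] L) : B.bilC (ratToC L v) (ratToC L w) = (B.bilQ v w : ℂ) := by
  induction v using TensorProduct.induction_on with
  | zero => simp
  | add v v' h h' => simp [h, h']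
  | tmul a x =>
    induction w using TensorProduct.induction_on with
    | zero => simp
    | add v v' h h' => simp [h, h']
    | tmul b y =>
      rw [ratToC_tmul, ratToC_tmul, bilC, bilQ, LinearMap.BilinForm.baseChange_tmul,
        LinearMap.BilinForm.baseChange_tmul]
      simp

theorem quadQ_incl (x : L) : ∃ n : ℤ, B.quadQ (inclQ L x) = n := by
  obtain ⟨n, hn⟩ := B.even x
  exact ⟨n, by rw [quadQ, bilQ_incl, hn]; push_cast; ring⟩

theorem quadC_incl (x : L) : ∃ n : ℤ, B.quadC (inclC L x) = n := by
  obtain ⟨n, hn⟩ := B.even x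
  exact ⟨n, by rw [quadC, bilC_incl, hn]; push_cast; ring⟩

theorem quadC_ratToC (v : ℚ ⊗[ℤ] L) : B.quadC (ratToC L v) = (B.quadQ v : ℂ) := by
  simp [quadC, quadQ, bilC_ratToC]

theorem quadC_add (v w : ℂ ⊗[ℤ] L) : B.quadC (v + w) = B.quadC v + B.quadC w + B.bilC v w := by
  simp only [quadC, map_add, LinearMap.add_apply, B.bilC_symm w v]; ring

theorem quadC_smul (a : ℂ) (v : ℂ ⊗[ℤ] L) : B.quadC (a • v) = a ^ 2 * B.quadC v := by
  simp only [quadC, map_smul, LinearMap.smul_apply, smul_eq_mul]; ring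

theorem quadQ_add (v w : ℚ ⊗[ℤ] L) : B.quadQ (v + w) = B.quadQ v + B.quadQ w + B.bilQ v w := by
  simp only [quadQ, map_add, LinearMap.add_apply, B.bilQ_symm w v]; ring

theorem mem_dual (v : ℚ ⊗[ℤ] L) :
    v ∈ B.dual ↔ ∀ x : L, ∃ n : ℤ, B.bilQ v (inclQ L x) = n := Iff.rfl

theorem mem_sub (r : B.dual) : r ∈ B.sub ↔ ∃ x : L, inclQ L x = r := Iff.rfl

theorem cls_eq (r s : B.dual) : B.cls r = B.cls s ↔ ∃ x : L, inclQ L x = (r : ℚ ⊗[ℤ] L) - s := by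
  rw [eq_comm, QuotientAddGroup.eq, mem_sub]
  simp [sub_eq_neg_add]

theorem coe_eq_of_sub_int {a b : ℚ} (n : ℤ) (h : a - b = n) :
    (a : AddCircle (1 : ℚ)) = (b : AddCircle (1 : ℚ)) := by
  rw [← sub_eq_zero, ← AddCircle.coe_sub, h, AddCircle.coe_eq_zero_iff]
  exact ⟨n, by simp⟩

/-- The discriminant form `x + L ↦ β(x) + ℤ` on `L^#/L`, with values in `ℚ/ℤ`. -/
def discQuad : B.Disc → AddCircle (1 : ℚ) :=
  Quotient.lift (fun r : B.dual => (B.quadQ r : AddCircle (1 : ℚ))) fun r s h => by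
    obtain ⟨x, hx⟩ := (B.cls_eq r s).1 (Quotient.sound h)
    obtain ⟨n, hn⟩ := B.quadQ_incl x
    obtain ⟨m, hm⟩ := (B.mem_dual s).1 s.2 x
    have h2 : (r : ℚ ⊗[ℤ] L) = s + inclQ L x := by rw [hx]; abel
    refine coe_eq_of_sub_int (n + m) ?_
    rw [h2, quadQ_add, hn, hm]; push_cast; ring

/-- The bilinear form `(x + L, y + L) ↦ β(x, y) + ℤ` on `L^#/L`, with values in `ℚ/ℤ`. -/
def discBil : B.Disc → B.Disc → AddCircle (1 : ℚ) :=
  Quotient.lift₂ (fun r s : B.dual => (B.bilQ r s : AddCircle (1 : ℚ))) fun r s r' s' h h' => by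
    obtain ⟨x, hx⟩ := (B.cls_eq r r').1 (Quotient.sound h)
    obtain ⟨y, hy⟩ := (B.cls_eq s s').1 (Quotient.sound h')
    obtain ⟨m, hm⟩ := (B.mem_dual s').1 s'.2 x
    obtain ⟨n, hn⟩ := (B.mem_dual r).1 r.2 y
    refine coe_eq_of_sub_int (n + m) ?_
    have e1 : (s : ℚ ⊗[ℤ] L) = s' + inclQ L y := by rw [hy]; abel
    have e2 : B.bilQ r (s' : ℚ ⊗[ℤ] L) = B.bilQ r' s' + m := by
      rw [show (r : ℚ ⊗[ℤ] L) = r' + inclQ L x by rw [hx]; abel, ← hm,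
        B.bilQ_symm (s' : ℚ ⊗[ℤ] L)]
      simp
    rw [e1, map_add, hn, e2]; push_cast; ring

theorem discQuad_cls (r : B.dual) : B.discQuad (B.cls r) = (B.quadQ r : AddCircle (1 : ℚ)) := rfl

theorem discBil_cls (r s : B.dual) :
    B.discBil (B.cls r) (B.cls s) = (B.bilQ r s : AddCircle (1 : ℚ)) := rfl

theorem exists_zsmul_mem_range (v : ℚ ⊗[ℤ] L) :
    ∃ n : ℤ, n ≠ 0 ∧ ∃ x : L, inclQ L x = (n : ℚ) • v := by
  induction v using TensorProduct.induction_on with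
  | zero => exact ⟨1, one_ne_zero, 0, by simp⟩
  | add v w hv hw =>
    obtain ⟨n, hn, x, hx⟩ := hv
    obtain ⟨m, hm, y, hy⟩ := hw
    refine ⟨n * m, mul_ne_zero hn hm, m • x + n • y, ?_⟩
    rw [map_add, map_zsmul, map_zsmul, hx, hy, smul_add, ← Int.cast_smul_eq_zsmul ℚ,
      ← Int.cast_smul_eq_zsmul ℚ, smul_smul, smul_smul]
    push_cast
    rw [mul_comm (m : ℚ) n]
  | tmul a x =>
    refine ⟨a.den, by exact_mod_cast a.den_nz, a.num • x, ?_⟩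
    rw [inclQ_apply, TensorProduct.tmul_smul, TensorProduct.smul_tmul', TensorProduct.smul_tmul']
    congr 1
    simp [mul_comm, Rat.mul_den_eq_num]

theorem eq_zero_of_bilQ_incl (v : ℚ ⊗[ℤ] L) (hv : ∀ x, B.bilQ v (inclQ L x) = 0) : v = 0 := by
  obtain ⟨n, hn, x, hx⟩ := exists_zsmul_mem_range v
  have h0 : B.bilQ (inclQ L x) (inclQ L x) = 0 := by
    nth_rewrite 1 [hx]
    rw [map_smul, LinearMap.smul_apply, hv, smul_zero]
  rw [bilQ_incl] at h0
  have h0' : B.form x x = 0 := by exact_mod_cast h0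
  have hx0 : x = 0 := by
    by_contra hne
    exact (B.pos x hne).ne' h0'
  rw [hx0, map_zero] at hx
  exact (smul_eq_zero.1 hx.symm).resolve_left (by exact_mod_cast hn)

instance finite_disc [Module.Finite ℤ L] : Finite B.Disc := by
  obtain ⟨S, hS⟩ := (Module.Finite.fg_top : (⊤ : Submodule ℤ L).FG)
  choose c hc using fun (v : B.dual) (x : L) => (B.mem_dual v).1 v.2 x
  let f : B.dual →+ (S → ℤ) :=
    { toFun := fun v x => c v x
      map_zero' := by
        funext x
        have := hc 0 x
        rw [AddSubgroup.coe_zero, map_zero, LinearMap.zero_apply] at this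
        simp only [Pi.zero_apply]
        exact_mod_cast this.symm
      map_add' := fun v w => by
        funext x
        have h := hc (v + w) x
        rw [AddSubgroup.coe_add, map_add, LinearMap.add_apply, hc, hc] at h
        simp only [Pi.add_apply]
        exact_mod_cast h.symm }
  have hf : Function.Injective f := by
    rw [injective_iff_map_eq_zero]
    intro v hv
    have h0 : ∀ x : L, B.bilQ v (inclQ L x) = 0 := by
      intro x
      have hx : x ∈ Submodule.span ℤ (S : Set L) := by rw [hS]; trivial
      induction hx using Submodule.span_induction with
      | mem x hx =>
        have : c v x = 0 := congrFun hv ⟨x, hx⟩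
        rw [hc, this, Int.cast_zero]
      | zero => simp
      | add x y _ _ hx hy => rw [map_add, map_add, hx, hy, add_zero]
      | smul a x _ hx => rw [map_zsmul, map_zsmul, hx, smul_zero]
    exact Subtype.ext (B.eq_zero_of_bilQ_incl v h0)
  have hfin : Module.Finite ℤ B.dual := Module.Finite.of_injective f.toIntLinearMap hf
  have hfin' : Module.Finite ℤ B.Disc :=
    Module.Finite.of_surjective (QuotientAddGroup.mk' B.sub).toIntLinearMap
      (QuotientAddGroup.mk'_surjective B.sub)
  refine Module.finite_of_fg_torsion _ fun {y} => ?_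
  obtain ⟨r, rfl⟩ := QuotientAddGroup.mk_surjective y
  obtain ⟨n, hn, x, hx⟩ := exists_zsmul_mem_range (r : ℚ ⊗[ℤ] L)
  refine ⟨⟨n, mem_nonZeroDivisors_of_ne_zero hn⟩, ?_⟩
  change n • (QuotientAddGroup.mk r : B.Disc) = 0
  rw [← QuotientAddGroup.mk_zsmul, QuotientAddGroup.eq_zero_iff, mem_sub]
  exact ⟨x, by rw [hx, AddSubgroup.coe_zsmul, Int.cast_smul_eq_zsmul]⟩

instance fintype_disc [Module.Finite ℤ L] : Fintype B.Disc := Fintype.ofFinite _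

end PosDefEvenForm

/-- The Jacobi group `SL₂(ℤ) ⋉ H_L(ℤ)`; the element `(A, (x, y))` is stored as `⟨A, x, y⟩`. -/
@[ext]
structure JacobiGroup (L : Type*) where
  A : SL(2, ℤ)
  x : L
  y : L

namespace JacobiGroup

/-- `(A, h)(A', h') = (AA', h^{A'} h')`, where `(x, y)^{A'} = (a'x + c'y, b'x + d'y)`. -/
instance : Mul (JacobiGroup L) where
  mul γ γ' := ⟨γ.A * γ'.A, γ'.A 0 0 • γ.x + γ'.A 1 0 • γ.y + γ'.x,
    γ'.A 0 1 • γ.x + γ'.A 1 1 • γ.y + γ'.y⟩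

instance : One (JacobiGroup L) where
  one := ⟨1, 0, 0⟩

instance : Inv (JacobiGroup L) where
  inv γ := ⟨γ.A⁻¹, -(γ.A⁻¹ 0 0 • γ.x + γ.A⁻¹ 1 0 • γ.y), -(γ.A⁻¹ 0 1 • γ.x + γ.A⁻¹ 1 1 • γ.y)⟩

@[simp] theorem mul_A (γ γ' : JacobiGroup L) : (γ * γ').A = γ.A * γ'.A := rfl
@[simp] theorem mul_x (γ γ' : JacobiGroup L) :
    (γ * γ').x = γ'.A 0 0 • γ.x + γ'.A 1 0 • γ.y + γ'.x := rfl
@[simp] theorem mul_y (γ γ' : JacobiGroup L) :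
    (γ * γ').y = γ'.A 0 1 • γ.x + γ'.A 1 1 • γ.y + γ'.y := rfl
@[simp] theorem one_A : (1 : JacobiGroup L).A = 1 := rfl
@[simp] theorem one_x : (1 : JacobiGroup L).x = 0 := rfl
@[simp] theorem one_y : (1 : JacobiGroup L).y = 0 := rfl
@[simp] theorem inv_A (γ : JacobiGroup L) : γ⁻¹.A = γ.A⁻¹ := rfl
@[simp] theorem inv_x (γ : JacobiGroup L) :
    γ⁻¹.x = -(γ.A⁻¹ 0 0 • γ.x + γ.A⁻¹ 1 0 • γ.y) := rfl
@[simp] theorem inv_y (γ : JacobiGroup L) :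
    γ⁻¹.y = -(γ.A⁻¹ 0 1 • γ.x + γ.A⁻¹ 1 1 • γ.y) := rfl

instance : Group (JacobiGroup L) :=
  Group.ofLeftAxioms
    (fun γ γ' γ'' => by
      ext1
      · simp [mul_assoc]
      · simp [Matrix.mul_apply, Fin.sum_univ_two, add_smul, mul_smul, smul_add]
        module
      · simp [Matrix.mul_apply, Fin.sum_univ_two, add_smul, mul_smul, smul_add]
        module)
    (fun γ => by ext1 <;> simp)
    (fun γ => by
      have h : γ.A 0 0 * γ.A 1 1 - γ.A 0 1 * γ.A 1 0 = 1 := by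
        rw [← Matrix.det_fin_two]; exact γ.A.det_coe
      ext1
      · simp
      · simp [Matrix.SpecialLinearGroup.coe_inv, Matrix.adjugate_fin_two]
        linear_combination (norm := module) (-h) • γ.x
      · simp [Matrix.SpecialLinearGroup.coe_inv, Matrix.adjugate_fin_two]
        linear_combination (norm := module) (-h) • γ.y)

end JacobiGroup

/-- `Γ_∞`, the group of all matrices `(1, n; 0, 1)` with `n ∈ ℤ`. -/
def gammaInf : Subgroup SL(2, ℤ) := Subgroup.zpowers ModularGroup.T

/-- `J_∞`, the group of all `((1, n; 0, 1), (0, μ))` with `n ∈ ℤ` and `μ ∈ L`. -/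
def jacobiInf (L : Type*) [AddCommGroup L] : Subgroup (JacobiGroup L) where
  carrier := {γ | γ.A ∈ gammaInf ∧ γ.x = 0}
  mul_mem' {γ γ'} h h' := by
    refine ⟨mul_mem h.1 h'.1, ?_⟩
    obtain ⟨n, hn⟩ := Subgroup.mem_zpowers_iff.1 h'.1
    simp [h.2, h'.2, ← hn, ModularGroup.coe_T_zpow]
  one_mem' := ⟨one_mem _, rfl⟩
  inv_mem' {γ} h := by
    refine ⟨inv_mem h.1, ?_⟩
    obtain ⟨n, hn⟩ := Subgroup.mem_zpowers_iff.1 h.1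
    simp [h.2, ← hn, ModularGroup.coe_T_zpow, Matrix.SpecialLinearGroup.coe_inv,
      Matrix.adjugate_fin_two]

/-- `Γ_∞ \ SL₂(ℤ)`, the set of cosets `Γ_∞ A`. -/
abbrev GammaCosets : Type := Quotient (QuotientGroup.rightRel gammaInf)

/-- `J_∞ \ J`, the set of cosets `J_∞ γ` in the Jacobi group `J`. -/
abbrev JacobiCosets (L : Type*) [AddCommGroup L] : Type _ :=
  Quotient (QuotientGroup.rightRel (jacobiInf L))

/-- The projection `J_∞ \ J → Γ_∞ \ SL₂(ℤ)` that sends the coset of `(A, h)` to that of `A`. -/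
def proj : JacobiCosets L → GammaCosets :=
  Quotient.map (fun γ => γ.A) fun γ γ' h => by
    have h' := QuotientGroup.rightRel_apply.1 h
    exact QuotientGroup.rightRel_apply.2 h'.1

/-- The automorphy factor `cτ + d`. -/
def autFactor (A : SL(2, ℤ)) (τ : ℍ) : ℂ := (A 1 0 : ℂ) * τ + (A 1 1 : ℂ)

namespace PosDefEvenForm

variable (B : PosDefEvenForm L)

/-- `(φ|_k A)(τ, z) = φ(Aτ, z/(cτ+d)) (cτ+d)^{-k} e(-cβ(z)/(cτ+d))`. -/
def slashSL (k : ℤ) (A : SL(2, ℤ)) (φ : ℍ → ℂ ⊗[ℤ] L → ℂ) : ℍ → ℂ ⊗[ℤ] L → ℂ := fun τ z =>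
  φ (A • τ) ((autFactor A τ)⁻¹ • z) * autFactor A τ ^ (-k) *
    e (-(A 1 0 : ℂ) * B.quadC z / autFactor A τ)

/-- `(φ|(x, y))(τ, z) = φ(τ, z + xτ + y) e(τβ(x) + β(x, z))`. -/
def slashHeis (x y : L) (φ : ℍ → ℂ ⊗[ℤ] L → ℂ) : ℍ → ℂ ⊗[ℤ] L → ℂ := fun τ z =>
  φ τ (z + (τ : ℂ) • inclC L x + inclC L y) *
    e ((τ : ℂ) * B.quadC (inclC L x) + B.bilC (inclC L x) z)

/-- The action `φ|_k (A, h) = (φ|_k A)|h` of the Jacobi group. -/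
def slash (k : ℤ) (γ : JacobiGroup L) (φ : ℍ → ℂ ⊗[ℤ] L → ℂ) : ℍ → ℂ ⊗[ℤ] L → ℂ :=
  B.slashHeis γ.x γ.y (B.slashSL k γ.A φ)

/-- `g_{D,r}(τ, z) = e(τ(β(r) - D) + β(r, z))`. -/
def gFun (D : ℚ) (r : B.dual) (τ : ℍ) (z : ℂ ⊗[ℤ] L) : ℂ :=
  e ((τ : ℂ) * ((B.quadQ r : ℂ) - (D : ℂ)) + B.bilC (ratToC L r) z)

/-- The term `g_{D,r}|_k γ (τ, z)` of the Poincaré and Eisenstein series that belongs to the coset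
`q = J_∞ γ`. It does not depend on the representative `γ` if `β(r) - D ∈ ℤ`, see
`cosetTerm_mk`. -/
def cosetTerm (k : ℤ) (D : ℚ) (r : B.dual) (q : JacobiCosets L) (τ : ℍ) (z : ℂ ⊗[ℤ] L) : ℂ :=
  B.slash k q.out (B.gFun D r) τ z

/-- The part of the sum of `g_{D,r}|_k γ` over `J_∞ \ J` that comes from the cosets of the
elements `γ = (A, h)` with `A` in a given coset `a` in `Γ_∞ \ SL₂(ℤ)`. -/
def fiberSum (k : ℤ) (D : ℚ) (r : B.dual) (a : GammaCosets) (τ : ℍ) (z : ℂ ⊗[ℤ] L) : ℂ :=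
  ∑' q : {q : JacobiCosets L // proj q = a}, B.cosetTerm k D r q τ z

/-- The series `∑ g_{D,r}|_k γ` over the cosets `J_∞ γ` in `J_∞ \ J`, where the cosets over each
element of `Γ_∞ \ SL₂(ℤ)` are summed first. This grouping does not matter if `k > rk(L) + 2`,
when the family of all terms is summable. For `D = 0` and `rk(L)/2 + 2 < k ≤ rk(L) + 2`, only the
grouped series converges absolutely. -/
def poincare (k : ℤ) (D : ℚ) (r : B.dual) (τ : ℍ) (z : ℂ ⊗[ℤ] L) : ℂ :=
  ∑' a : GammaCosets, B.fiberSum k D r a τ z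

/-- The Jacobi-Eisenstein series `E_r` of weight `k`, for `r` in `L^#` with `β(r) ∈ ℤ`. -/
def eisenstein (k : ℤ) (r : B.dual) (τ : ℍ) (z : ℂ ⊗[ℤ] L) : ℂ :=
  1 / 2 * B.poincare k 0 r τ z

/-- The Jacobi-Eisenstein series `E_x` of weight `k`, for an isotropic class `x` in `L^#/L`. It is
`E_r` for any `r` in `L^#` that represents `x`, see `eisensteinCls_mk`. -/
def eisensteinCls (k : ℤ) (x : B.Disc) : ℍ → ℂ ⊗[ℤ] L → ℂ :=
  B.eisenstein k (Quotient.out x)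

/-- The series that defines `E_r` converges: for all `(τ, z)`, the sum over each fibre of
`J_∞ \ J → Γ_∞ \ SL₂(ℤ)` is absolutely convergent, and so is the sum over `Γ_∞ \ SL₂(ℤ)`. -/
def EisensteinConverges (k : ℤ) (r : B.dual) : Prop :=
  ∀ (τ : ℍ) (z : ℂ ⊗[ℤ] L),
    (∀ a : GammaCosets,
      Summable fun q : {q : JacobiCosets L // proj q = a} => B.cosetTerm k 0 r q τ z) ∧
    Summable fun a : GammaCosets => B.fiberSum k 0 r a τ z

/-- The term `e(τβ(r) + β(r, z))` of a Jacobi theta series. -/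
def thetaTerm (r : B.dual) (τ : ℍ) (z : ℂ ⊗[ℤ] L) : ℂ :=
  e ((τ : ℂ) * (B.quadQ r : ℂ) + B.bilC (ratToC L r) z)

/-- The Jacobi theta series `ϑ_{L,x}(τ, z) = ∑ e(τβ(r) + β(r, z))`, the sum over all `r` in `L^#`
in the class `x`. -/
def theta (x : B.Disc) (τ : ℍ) (z : ℂ ⊗[ℤ] L) : ℂ :=
  ∑' r : {r : B.dual // B.cls r = x}, B.thetaTerm r τ z

/-- The support `{(D, r) : r ∈ L^#, D ∈ ℚ, D ≤ 0, D ≡ β(r) mod ℤ}` of the lattice. -/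
def supp : Set (ℚ × B.dual) := {p | p.1 ≤ 0 ∧ ∃ n : ℤ, B.quadQ p.2 - p.1 = n}

/-- `φ` has the absolutely convergent Fourier expansion
`φ(τ, z) = ∑ C(D, r) e((β(r) - D)τ + β(r, z))`, the sum over all `(D, r)` in the support, where
`C(D, r)` depends only on `D` and on the class of `r` in `L^#/L`. -/
def HasFourierExpansion (φ : ℍ → ℂ ⊗[ℤ] L → ℂ) (C : ℚ → B.Disc → ℂ) : Prop :=
  ∀ (τ : ℍ) (z : ℂ ⊗[ℤ] L),
    HasSum (fun p : B.supp => C p.1.1 (B.cls p.1.2) * B.gFun p.1.1 p.1.2 τ z) (φ τ z)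

open Classical in
/-- The Fourier coefficients `C(D, y)` of `φ` (zero if `φ` has no Fourier expansion). -/
def fourierCoeff (φ : ℍ → ℂ ⊗[ℤ] L → ℂ) : ℚ → B.Disc → ℂ :=
  if h : ∃ C, B.HasFourierExpansion φ C then h.choose else 0

/-- All `D` with `(D, y)` in the support, for a class `y` in `L^#/L`. -/
def suppAt (y : B.Disc) : Set ℚ := {D | D ≤ 0 ∧ (D : AddCircle (1 : ℚ)) = B.discQuad y}

/-- The term `C(D, y) q^{-D}` of `h_{φ,y}(τ)`, where `q = e(τ)`. -/
def hTerm (φ : ℍ → ℂ ⊗[ℤ] L → ℂ) (y : B.Disc) (D : ℚ) (τ : ℍ) : ℂ :=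
  B.fourierCoeff φ D y * e (-(D : ℂ) * τ)

/-- `h_{φ,y}(τ) = ∑ C(D, y) q^{-D}`, the sum over all `D` with `(D, y)` in the support. -/
def hComp (φ : ℍ → ℂ ⊗[ℤ] L → ℂ) (y : B.Disc) (τ : ℍ) : ℂ :=
  ∑' D : B.suppAt y, B.hTerm φ y D τ

/-! ### The series are well defined -/

theorem autFactor_ne_zero (A : SL(2, ℤ)) (τ : ℍ) : autFactor A τ ≠ 0 := by
  have := UpperHalfPlane.denom_ne_zero (A : GL (Fin 2) ℝ) τ
  rwa [ModularGroup.denom_apply] at this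

theorem autFactor_mul_smul (A : SL(2, ℤ)) (τ : ℍ) :
    autFactor A τ * ((A • τ : ℍ) : ℂ) = (A 0 0 : ℂ) * τ + (A 0 1 : ℂ) := by
  have h0 := autFactor_ne_zero A τ
  rw [UpperHalfPlane.coe_specialLinearGroup_apply]
  simp only [autFactor] at h0 ⊢
  simp only [algebraMap_int_eq, eq_intCast, Complex.ofReal_intCast]
  rw [mul_div_cancel₀ _ h0]

theorem det_eq (A : SL(2, ℤ)) :
    (A 0 0 : ℂ) * (A 1 1 : ℂ) - (A 0 1 : ℂ) * (A 1 0 : ℂ) = 1 := by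
  have h : A 0 0 * A 1 1 - A 0 1 * A 1 0 = 1 := by
    rw [← Matrix.det_fin_two]; exact A.det_coe
  exact_mod_cast h

theorem autFactor_mul (A A' : SL(2, ℤ)) (τ : ℍ) :
    autFactor (A * A') τ = autFactor A (A' • τ) * autFactor A' τ := by
  have h := autFactor_mul_smul A' τ
  simp only [autFactor, Matrix.SpecialLinearGroup.coe_mul, Matrix.mul_apply, Fin.sum_univ_two]
    at h ⊢
  push_cast
  linear_combination -(A 1 0 : ℂ) * h

/-- The slash operation is a right action of the Jacobi group. -/
theorem slash_mul (k : ℤ) (γ γ' : JacobiGroup L) (φ : ℍ → ℂ ⊗[ℤ] L → ℂ) :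
    B.slash k (γ * γ') φ = B.slash k γ' (B.slash k γ φ) := by
  funext τ z
  obtain ⟨A, x, y⟩ := γ
  obtain ⟨A', x', y'⟩ := γ'
  simp only [slash, slashHeis, slashSL, JacobiGroup.mul_A, JacobiGroup.mul_x, JacobiGroup.mul_y]
  rw [autFactor_mul, mul_smul]
  have hN := autFactor_mul_smul A' τ
  have hdet := det_eq A'
  have hJ'0 := autFactor_ne_zero A' τ
  have hJ0 := autFactor_ne_zero A (A' • τ)
  have hJ' : autFactor A' τ = (A' 1 0 : ℂ) * τ + (A' 1 1 : ℂ) := rfl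
  have hJ : autFactor A (A' • τ) = (A 1 0 : ℂ) * ((A' • τ : ℍ) : ℂ) + (A 1 1 : ℂ) := rfl
  set J' := autFactor A' τ with hJ'def
  set J := autFactor A (A' • τ) with hJdef
  set τ' := A' • τ with hτ'
  have hC : (((A * A' : SL(2, ℤ)) 1 0 : ℤ) : ℂ) = (A 1 0 : ℂ) * A' 0 0 + A 1 1 * A' 1 0 := by
    simp [Matrix.mul_apply, Fin.sum_univ_two]
  rw [hC]
  obtain ⟨w, hw⟩ : ∃ w, w = J'⁻¹ • (z + (τ : ℂ) • inclC L x' + inclC L y') := ⟨_, rfl⟩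
  have hz : z = J' • w - (τ : ℂ) • inclC L x' - inclC L y' := by
    rw [hw, smul_smul, mul_inv_cancel₀ hJ'0, one_smul]; abel
  have hX : inclC L (A' 0 0 • x + A' 1 0 • y + x') =
      (A' 0 0 : ℂ) • inclC L x + (A' 1 0 : ℂ) • inclC L y + inclC L x' := by
    simp [map_zsmul, Int.cast_smul_eq_zsmul]
  have hY : inclC L (A' 0 1 • x + A' 1 1 • y + y') =
      (A' 0 1 : ℂ) • inclC L x + (A' 1 1 : ℂ) • inclC L y + inclC L y' := by
    simp [map_zsmul, Int.cast_smul_eq_zsmul]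
  have hZ : z + (τ : ℂ) • inclC L (A' 0 0 • x + A' 1 0 • y + x') +
      inclC L (A' 0 1 • x + A' 1 1 • y + y') =
      J' • (w + (τ' : ℂ) • inclC L x + inclC L y) := by
    have h1 : J' • (w + (τ' : ℂ) • inclC L x + inclC L y) =
        J' • w + (J' * τ') • inclC L x + J' • inclC L y := by module
    rw [h1, hX, hY, hz, hN]
    nth_rewrite 3 [hJ']
    module
  rw [hZ, hX, ← hw]
  have hw' : (J * J')⁻¹ • J' • (w + (τ' : ℂ) • inclC L x + inclC L y) =
      J⁻¹ • (w + (τ' : ℂ) • inclC L x + inclC L y) := by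
    rw [smul_smul]; congr 1; field_simp
  have hz' : z + (τ : ℂ) • inclC L x' + inclC L y' = J' • w := by rw [hz]; abel
  rw [hw', hz', mul_zpow]
  have key : e (-((A 1 0 : ℂ) * A' 0 0 + A 1 1 * A' 1 0) *
        B.quadC (J' • (w + (τ' : ℂ) • inclC L x + inclC L y)) / (J * J')) *
      e ((τ : ℂ) * B.quadC ((A' 0 0 : ℂ) • inclC L x + (A' 1 0 : ℂ) • inclC L y + inclC L x') +
        B.bilC ((A' 0 0 : ℂ) • inclC L x + (A' 1 0 : ℂ) • inclC L y + inclC L x') z) =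
      e (-(A 1 0 : ℂ) * B.quadC (w + (τ' : ℂ) • inclC L x + inclC L y) / J) *
      e ((τ' : ℂ) * B.quadC (inclC L x) + B.bilC (inclC L x) w) *
      e (-(A' 1 0 : ℂ) * B.quadC (J' • w) / J') *
      e ((τ : ℂ) * B.quadC (inclC L x') + B.bilC (inclC L x') z) := by
    simp only [← e_add]
    obtain ⟨qx, hqx⟩ := B.quadC_incl x
    obtain ⟨qy, hqy⟩ := B.quadC_incl y
    refine e_eq_of_sub_int
      (-(A' 0 0 * A' 0 1 * qx) - A' 1 0 * A' 1 1 * qy - A' 0 1 * A' 1 0 * B.form x y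
        - A' 0 0 * B.form x y' - A' 1 0 * B.form y y') ?_
    have hsplit : -((A 1 0 : ℂ) * A' 0 0 + A 1 1 * A' 1 0) *
          B.quadC (J' • (w + (τ' : ℂ) • inclC L x + inclC L y)) / (J * J') =
        -(A 1 0 : ℂ) * B.quadC (w + (τ' : ℂ) • inclC L x + inclC L y) / J -
          A' 1 0 * J' * B.quadC (w + (τ' : ℂ) • inclC L x + inclC L y) := by
      have hc : ((A 1 0 : ℂ) * A' 0 0 + A 1 1 * A' 1 0) * J' = A 1 0 + A' 1 0 * J' * J := by
        rw [hJ]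
        linear_combination (A 1 0 : ℂ) * A' 0 0 * hJ' - (A 1 0 : ℂ) * A' 1 0 * hN +
          (A 1 0 : ℂ) * hdet
      rw [quadC_smul]
      field_simp
      linear_combination (-B.quadC (w + (τ' : ℂ) • inclC L x + inclC L y)) * hc
    have hsplit' : -(A' 1 0 : ℂ) * B.quadC (J' • w) / J' = -(A' 1 0 : ℂ) * J' * B.quadC w := by
      rw [quadC_smul]; field_simp
    rw [hsplit, hsplit', hz]
    simp only [quadC_add, quadC_smul, map_add, map_sub, map_smul, LinearMap.add_apply,
      LinearMap.smul_apply, smul_eq_mul, hqx, hqy, bilC_incl, B.bilC_symm w]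
    push_cast
    linear_combination
      (qx : ℂ) * (-(A' 1 0 : ℂ) * τ' * hN + τ' * hdet + (A' 0 0 : ℂ) * τ' * hJ' -
        (A' 0 0 : ℂ) * hN) +
      B.bilC (inclC L x) w * (-(A' 1 0 : ℂ) * hN + (A' 0 0 : ℂ) * hJ' + hdet) -
      (A' 1 0 : ℂ) * qy * hJ' - (A' 1 0 : ℂ) * (B.form x y : ℂ) * hN
  linear_combination (φ (A • τ') (J⁻¹ • (w + (τ' : ℂ) • inclC L x + inclC L y)) *
    (J ^ (-k) * J' ^ (-k))) * key

theorem gFun_slash_of_mem (k : ℤ) (D : ℚ) (r : B.dual) (hr : ∃ n : ℤ, B.quadQ r - D = n)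
    {γ : JacobiGroup L} (hγ : γ ∈ jacobiInf L) : B.slash k γ (B.gFun D r) = B.gFun D r := by
  obtain ⟨A, x, y⟩ := γ
  obtain ⟨⟨n, hn⟩, hx⟩ := hγ
  simp only at hn hx
  subst hx
  obtain ⟨m, hm⟩ := hr
  obtain ⟨l, hl⟩ := (B.mem_dual r).1 r.2 y
  have hA : (A : Matrix (Fin 2) (Fin 2) ℤ) = !![1, n; 0, 1] := by
    rw [← hn]; exact ModularGroup.coe_T_zpow n
  have h10 : A 1 0 = 0 := by simp [hA]
  have h11 : A 1 1 = 1 := by simp [hA]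
  have h00 : A 0 0 = 1 := by simp [hA]
  have h01 : A 0 1 = n := by simp [hA]
  funext τ z
  have hJ : autFactor A τ = 1 := by simp [autFactor, h10, h11]
  have hτ := autFactor_mul_smul A τ
  rw [hJ, h00, h01, one_mul, Int.cast_one, one_mul] at hτ
  have hl' : B.bilC (ratToC L r) (inclC L y) = l := by
    rw [← ratToC_incl, bilC_ratToC, hl, Rat.cast_intCast]
  have hm' : (B.quadQ r : ℂ) - (D : ℂ) = m := by
    rw [← Rat.cast_sub, hm, Rat.cast_intCast]
  have h0 : B.quadC 0 = 0 := by simp [quadC]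
  simp only [slash, slashHeis, slashSL, gFun, hJ, hτ, h10, h0, hm', map_zero, smul_zero, add_zero,
    map_add, hl', LinearMap.zero_apply, inv_one, one_smul, one_zpow, mul_one, mul_zero, neg_zero,
    zero_mul, zero_div, Int.cast_zero]
  rw [show e 0 = 1 by simpa using e_intCast 0, mul_one, mul_one]
  exact e_eq_of_sub_int (n * m + l) (by push_cast; ring)

/-- The terms of the series do not depend on the choice of coset representatives. -/
theorem cosetTerm_mk (k : ℤ) (D : ℚ) (r : B.dual) (hr : ∃ n : ℤ, B.quadQ r - D = n)
    (γ : JacobiGroup L) (τ : ℍ) (z : ℂ ⊗[ℤ] L) :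
    B.cosetTerm k D r (Quotient.mk _ γ) τ z = B.slash k γ (B.gFun D r) τ z := by
  have h := QuotientGroup.rightRel_apply.1
    (Quotient.mk_out (s := QuotientGroup.rightRel (jacobiInf L)) γ)
  rw [cosetTerm]
  conv_rhs => rw [← inv_mul_cancel_right γ (Quotient.mk _ γ : JacobiCosets L).out, slash_mul,
    B.gFun_slash_of_mem k D r hr h]

theorem gFun_translate (k : ℤ) (r s : B.dual) (l : L)
    (hrs : (r : ℚ ⊗[ℤ] L) = s + inclQ L l) :
    B.gFun 0 r = B.slash k ⟨1, l, 0⟩ (B.gFun 0 s) := by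
  funext τ z
  have hJ : autFactor 1 τ = 1 := by simp [autFactor]
  have h0 : (1 : SL(2, ℤ)) 1 0 = 0 := by simp
  have hl2 : B.bilC (ratToC L s) (inclC L l) = (B.bilQ s (inclQ L l) : ℂ) := by
    rw [← ratToC_incl, bilC_ratToC]
  have hq2 : B.quadC (inclC L l) = (B.quadQ (inclQ L l) : ℂ) := by
    rw [← ratToC_incl, quadC_ratToC]
  simp only [slash, slashHeis, slashSL, gFun, hJ, hrs, map_add, ratToC_incl, quadQ_add, one_smul,
    h0, hl2, hq2, map_zero, add_zero, map_smul, inv_one, one_zpow, mul_one,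
    Int.cast_zero, neg_zero, zero_mul, zero_div, LinearMap.add_apply, smul_eq_mul]
  rw [show e 0 = 1 by simpa using e_intCast 0, mul_one, ← e_add]
  congr 1
  push_cast; ring

theorem conj_mem_jacobiInf (l : L) {γ : JacobiGroup L} (hγ : γ ∈ jacobiInf L) :
    (⟨1, l, 0⟩ : JacobiGroup L) * γ * (⟨1, l, 0⟩ : JacobiGroup L)⁻¹ ∈ jacobiInf L := by
  obtain ⟨A, x, y⟩ := γ
  obtain ⟨⟨n, hn⟩, hx⟩ := hγ
  simp only at hn hx
  subst hx
  have hA : (A : Matrix (Fin 2) (Fin 2) ℤ) = !![1, n; 0, 1] := by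
    rw [← hn]; exact ModularGroup.coe_T_zpow n
  exact ⟨⟨n, by simp [hn]⟩, by simp [hA]⟩

theorem inv_translate (l : L) :
    (⟨1, l, 0⟩ : JacobiGroup L)⁻¹ = ⟨1, -l, 0⟩ := by
  ext1 <;> simp

/-- The map `J_∞ γ ↦ J_∞ (1, (l, 0)) γ`. -/
def translateCosets (l : L) : JacobiCosets L → JacobiCosets L :=
  Quotient.map (⟨1, l, 0⟩ * ·) fun γ γ' h => by
    refine QuotientGroup.rightRel_apply.2 ?_
    have := conj_mem_jacobiInf l (QuotientGroup.rightRel_apply.1 h)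
    simpa [mul_assoc] using this

theorem translateCosets_mk (l : L) (γ : JacobiGroup L) :
    translateCosets l (Quotient.mk _ γ) = Quotient.mk _ (⟨1, l, 0⟩ * γ) := rfl

theorem translateCosets_neg (l : L) (q : JacobiCosets L) :
    translateCosets (-l) (translateCosets l q) = q := by
  induction q using Quotient.inductionOn with
  | h γ => rw [translateCosets_mk, translateCosets_mk, ← mul_assoc, ← inv_translate,
      inv_mul_cancel, one_mul]

theorem proj_translateCosets (l : L) (q : JacobiCosets L) : proj (translateCosets l q) = proj q := by
  induction q using Quotient.inductionOn with
  | h γ =>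
    change (Quotient.mk _ (1 * γ.A) : GammaCosets) = Quotient.mk _ γ.A
    rw [one_mul]

/-- The bijection `J_∞ γ ↦ J_∞ (1, (l, 0)) γ` of the fibre over `a`. -/
def translateFiber (l : L) (a : GammaCosets) :
    {q : JacobiCosets L // proj q = a} ≃ {q : JacobiCosets L // proj q = a} where
  toFun q := ⟨translateCosets l q, by rw [proj_translateCosets, q.2]⟩
  invFun q := ⟨translateCosets (-l) q, by rw [proj_translateCosets, q.2]⟩
  left_inv q := Subtype.ext (translateCosets_neg l q)
  right_inv q := Subtype.ext (by simpa using translateCosets_neg (-l) (q : JacobiCosets L))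

/-- The series `E_r` depends only on the class of `r` in `L^#/L`. -/
theorem eisenstein_eq_of_cls_eq (k : ℤ) (r s : B.dual) (hr : ∃ n : ℤ, B.quadQ r = n)
    (h : B.cls r = B.cls s) : B.eisenstein k r = B.eisenstein k s := by
  obtain ⟨l, hl⟩ := (B.cls_eq r s).1 h
  have hrs : (r : ℚ ⊗[ℤ] L) = s + inclQ L l := by rw [hl]; abel
  obtain ⟨n, hn⟩ := hr
  obtain ⟨q, hq⟩ := B.quadQ_incl l
  obtain ⟨m, hm⟩ := (B.mem_dual s).1 s.2 l
  have hs : ∃ n : ℤ, B.quadQ s - 0 = n := by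
    refine ⟨n - q - m, ?_⟩
    have := B.quadQ_add s (inclQ L l)
    rw [← hrs, hn, hq, hm] at this
    push_cast; linarith
  have hr : ∃ n : ℤ, B.quadQ r - 0 = n := ⟨n, by rw [hn, sub_zero]⟩
  have hterm : ∀ q τ z,
      B.cosetTerm k 0 r q τ z = B.cosetTerm k 0 s (translateCosets l q) τ z := by
    intro q τ z
    induction q using Quotient.inductionOn with
    | h γ =>
      rw [translateCosets_mk, B.cosetTerm_mk k 0 r hr, B.cosetTerm_mk k 0 s hs,
        slash_mul, B.gFun_translate k r s l hrs]
  funext τ z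
  have hf : ∀ a, B.fiberSum k 0 r a τ z = B.fiberSum k 0 s a τ z := by
    intro a
    rw [fiberSum, fiberSum,
      ← (translateFiber l a).tsum_eq fun q => B.cosetTerm k 0 s (q : JacobiCosets L) τ z]
    exact tsum_congr fun q => hterm q τ z
  simp only [eisenstein, poincare, hf]

theorem eisensteinCls_mk (k : ℤ) (r : B.dual) (hr : ∃ n : ℤ, B.quadQ r = n) :
    B.eisensteinCls k (B.cls r) = B.eisenstein k r :=
  (B.eisenstein_eq_of_cls_eq k r _ hr (QuotientAddGroup.out_eq' (B.cls r)).symm).symm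

end PosDefEvenForm

end LatticeJacobi

end

/-!
The lattice `L` has only finitely many theta series `ϑ_y`, one for each class `y` in `L^#/L`, and for
fixed `τ` they are linearly independent functions of `z` (`theta_linearIndependent`). The proof
reduces every assertion to finite matrices acting on the vector of these theta series.

*The Weil representation.* For `A` in `SL₂(ℤ)`, the transforms of the `ϑ_y` under `A` are a scalar
factor of absolute value `|cτ + d|^{n/2}`, with `n` the rank of `L`, times the image of the vector
`(ϑ_y)` under a unitary matrix `ρ(A)`; see `IsWeil` and `exists_isWeil`. It suffices to check this
for the generators. The case of `T` is immediate. The case of `S` is Poisson summation over `L`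
(`hasSum_gaussian_lattice`): for a sublattice with an orthogonal basis it is a product of functional
equations of the one-dimensional theta function, and the sum over the cosets of such a sublattice
in `L` gives the general case. The constant in the formula for `S` follows from the evaluation of
`S²`.

*Convergence.* The terms of `E_r` over the coset of `A` add up to the transform of `ϑ_{L,r}` under
`A` (`hasSum_cosetTerm`). Since `ρ(A)` is unitary, this is at most a constant times
`|cτ + d|^{n/2 - k}`, so the series converges for `k > n/2 + 2`. Summation over `Γ_∞ \ SL₂(ℤ)` yields
`E_0 = ∑ h_y ϑ_y`, where the `h_y` are holomorphic and bounded at the cusp. By linear independence of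
the `ϑ_y`, the invariance of `E_0` under `T` gives `h_y(τ + 1) = e(-β(y)) h_y(τ)`, so `h_y` has an
expansion over the support (`exists_suppAt_expansion`), and `E_0` has a Fourier expansion.

*The identity.* For isotropic `x`, let `P` be the operator that maps `ϑ_y` to `∑ ϑ_{y + l x}` if `y` is
orthogonal to `x` and to `0` otherwise (`isoMatrix`). It commutes with the Weil representation, as one
verifies on the generators, and maps `ϑ_0` to `∑ ϑ_{l x}`. Hence it maps `E_0 = ∑ h_y ϑ_y` to
`∑ E_{l x}` (`exists_theta_decomposition`), and the coefficient of `ϑ_y` in the image is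
`∑ h_{y - l x}` for `y` orthogonal to `x`, and `0` otherwise.
-/

noncomputable section

open scoped Manifold

namespace LatticeJacobi

variable {L : Type*} [AddCommGroup L]

/-! ### Products of one-dimensional series -/

/-- A product of finitely many absolutely convergent series over `ℤ` may be expanded into an
absolutely convergent series over `ℤⁿ`. -/
theorem hasSum_pi_prod {n : ℕ} (f : Fin n → ℤ → ℂ) (hf : ∀ i, Summable fun m => ‖f i m‖) :
    (Summable fun k : Fin n → ℤ => ‖∏ i, f i (k i)‖) ∧
      HasSum (fun k : Fin n → ℤ => ∏ i, f i (k i)) (∏ i, ∑' m, f i m) := by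
  induction n with
  | zero =>
    refine ⟨(hasSum_fintype _).summable, ?_⟩
    simp
  | succ n ih =>
    obtain ⟨h1, h2⟩ := ih (fun i => f i.succ) fun i => hf i.succ
    set g : (Fin n → ℤ) → ℂ := fun k => ∏ i, f i.succ (k i) with hg
    have hs := Summable.mul_norm (R := ℂ) (f := f 0) (g := g) (hf 0) h1
    have hp : (fun k : Fin (n + 1) → ℤ => ∏ i, f i (k i)) ∘ (Fin.consEquiv fun _ => ℤ) =
        fun p : ℤ × (Fin n → ℤ) => f 0 p.1 * g p.2 := by
      funext p
      simp [Fin.prod_univ_succ, Fin.consEquiv, hg]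
    constructor
    · refine ((Fin.consEquiv fun _ => ℤ).summable_iff).1 ?_
      refine hs.congr fun p => ?_
      exact congrArg norm (congrFun hp p).symm
    · refine ((Fin.consEquiv fun _ => ℤ).hasSum_iff).1 ?_
      rw [hp, Fin.prod_univ_succ, ← h2.tsum_eq, tsum_mul_tsum_of_summable_norm (hf 0) h1]
      exact hs.of_norm.hasSum

theorem cpow_half_div {τ : ℂ} (hτ : τ ≠ 0) {N : ℝ} (hN : 0 < N) :
    (τ / N) ^ (1 / 2 : ℂ) = ((N ^ (-(1 / 2) : ℝ) : ℝ) : ℂ) * τ ^ (1 / 2 : ℂ) := by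
  have hN' : ((N⁻¹ : ℝ) : ℂ) ≠ 0 := by exact_mod_cast (inv_pos.2 hN).ne'
  rw [show τ / N = ((N⁻¹ : ℝ) : ℂ) * τ by push_cast; field_simp,
    Complex.cpow_def_of_ne_zero (mul_ne_zero hN' hτ),
    Complex.log_ofReal_mul (inv_pos.2 hN) hτ, add_mul, Complex.exp_add,
    Complex.cpow_def_of_ne_zero hτ, Real.log_inv, Real.rpow_def_of_pos hN, Complex.ofReal_exp]
  congr 2
  push_cast
  ring

theorem summable_norm_jacobiTheta₂_term (t : ℂ) {τ : ℂ} (hτ : 0 < τ.im) :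
    Summable fun m : ℤ => ‖jacobiTheta₂_term m t τ‖ :=
  ((summable_jacobiTheta₂_term_iff t τ).2 hτ).norm

theorem im_div_ofReal_pos (τ : ℍ) {N : ℝ} (hN : 0 < N) : 0 < ((τ : ℂ) / N).im := by
  rw [Complex.div_ofReal_im]; exact div_pos τ.im_pos hN

/-- The functional equation of the one-dimensional theta function, as Poisson summation for a
Gaussian with complex shift. -/
theorem hasSum_gaussian (τ : ℍ) (t : ℂ) {N : ℝ} (hN : 0 < N) :
    (Summable fun m : ℤ => ‖Complex.exp (-Real.pi * Complex.I * N * (m + t) ^ 2 / τ)‖) ∧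
      HasSum (fun m : ℤ => Complex.exp (-Real.pi * Complex.I * N * (m + t) ^ 2 / τ))
        ((N ^ (-(1 / 2) : ℝ) : ℝ) * (-Complex.I * τ) ^ (1 / 2 : ℂ) * jacobiTheta₂ t (τ / N)) := by
  have hτ0 : (τ : ℂ) ≠ 0 := UpperHalfPlane.ne_zero τ
  have hN0 : (N : ℂ) ≠ 0 := by exact_mod_cast hN.ne'
  have him : 0 < (-1 / ((τ : ℂ) / N)).im := by
    have := UpperHalfPlane.im_inv_neg_coe_pos ⟨_, im_div_ofReal_pos τ hN⟩
    rwa [UpperHalfPlane.coe_mk, inv_neg, ← one_div, ← neg_div] at this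
  have hI : -Complex.I * (τ / N) = -Complex.I * τ / N := by ring
  have hc0 : -Complex.I * (τ : ℂ) ≠ 0 := mul_ne_zero (neg_ne_zero.2 Complex.I_ne_zero) hτ0
  have hc : (-Complex.I * (τ / N)) ^ (1 / 2 : ℂ) ≠ 0 := by
    rw [hI, Ne, Complex.cpow_eq_zero_iff]
    exact fun h => (div_ne_zero hc0 hN0) h.1
  -- the sign of the summation index is free, so `jacobiTheta₂` may be taken at `-t`
  have key : ∀ m : ℤ, Complex.exp (-Real.pi * Complex.I * N * (m + t) ^ 2 / τ) =
      Complex.exp (-Real.pi * Complex.I * (-t) ^ 2 / (τ / N)) *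
        jacobiTheta₂_term m (-t / (τ / N)) (-1 / (τ / N)) := by
    intro m
    rw [jacobiTheta₂_term, ← Complex.exp_add]
    congr 1
    field_simp
    ring
  have hs := summable_norm_jacobiTheta₂_term (-t / (τ / N)) him
  constructor
  · simp only [key, norm_mul]
    exact hs.mul_left _
  · have h := (hasSum_jacobiTheta₂_term (-t / (τ / N)) him).mul_left
      (Complex.exp (-Real.pi * Complex.I * (-t) ^ 2 / (τ / N)))
    simp only [← key] at h
    have h1 := jacobiTheta₂_functional_equation (-t) (τ / N)
    rw [jacobiTheta₂_neg_left] at h1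
    rw [← cpow_half_div hc0 hN, ← hI, h1, mul_assoc (1 / _), ← mul_assoc, mul_one_div_cancel hc,
      one_mul]
    exact h

/-! ### Orthogonal frames -/

/-- An orthogonal frame of the lattice: vectors `w₁, …, wₙ` of `L`, with `n` the rank, that are
orthogonal for `β` and form a basis of `L ⊗ ℚ`. The last fact is encoded by Parseval's identity. -/
structure OrthoFrame (B : PosDefEvenForm L) where
  w : Fin (Module.finrank ℤ L) → L
  ortho : ∀ i j, i ≠ j → B.form (w i) (w j) = 0
  pos : ∀ i, 0 < B.form (w i) (w i)
  parseval : ∀ v v' : ℚ ⊗[ℤ] L, B.bilQ v v' =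
    ∑ i, B.bilQ v (inclQ L (w i)) * B.bilQ v' (inclQ L (w i)) / B.form (w i) (w i)

theorem PosDefEvenForm.exists_orthoFrame [Module.Free ℤ L] [Module.Finite ℤ L]
    (B : PosDefEvenForm L) : Nonempty (OrthoFrame B) := by
  have hsymm : LinearMap.IsSymm B.bilQ := ⟨fun v w => B.bilQ_symm v w⟩
  have hfr : Module.finrank ℚ (ℚ ⊗[ℤ] L) = Module.finrank ℤ L := Module.finrank_baseChange
  obtain ⟨v, hv⟩ : ∃ v : Module.Basis (Fin (Module.finrank ℤ L)) ℚ (ℚ ⊗[ℤ] L),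
      LinearMap.IsOrthoᵢ B.bilQ v := by
    rw [← hfr]; exact LinearMap.BilinForm.exists_orthogonal_basis hsymm
  choose m hm x hx using fun i => PosDefEvenForm.exists_zsmul_mem_range (v i)
  have hm' : ∀ i, (m i : ℚ) ≠ 0 := fun i => by exact_mod_cast hm i
  have hx0 : ∀ i, x i ≠ 0 := by
    intro i h
    have := hx i
    rw [h, map_zero, eq_comm, smul_eq_zero] at this
    exact this.elim (hm' i) (v.ne_zero i)
  have hpos : ∀ i, 0 < B.form (x i) (x i) := fun i => B.pos _ (hx0 i)
  have hform : ∀ i j, (B.form (x i) (x j) : ℚ) = m i * m j * B.bilQ (v i) (v j) := by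
    intro i j
    rw [← B.bilQ_incl, hx, hx]
    simp only [map_smul, LinearMap.smul_apply, smul_eq_mul]; ring
  have hort : ∀ i j, i ≠ j → B.bilQ (v i) (v j) = 0 := fun i j hij =>
    LinearMap.isOrthoᵢ_def.1 hv i j hij
  refine ⟨⟨x, fun i j hij => ?_, hpos, ?_⟩⟩
  · have := hform i j
    rw [hort i j hij, mul_zero] at this
    exact_mod_cast this
  · let F : LinearMap.BilinForm ℚ (ℚ ⊗[ℤ] L) := ∑ i, ((B.form (x i) (x i) : ℚ)⁻¹) •
      LinearMap.BilinForm.linMulLin (B.bilQ (inclQ L (x i))) (B.bilQ (inclQ L (x i)))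
    have hF : B.bilQ = F := by
      refine LinearMap.BilinForm.ext_basis v fun a b => ?_
      simp only [F, LinearMap.BilinForm.sum_apply, LinearMap.smul_apply,
        LinearMap.BilinForm.linMulLin_apply, hx, map_smul, LinearMap.smul_apply, smul_eq_mul]
      rw [Finset.sum_eq_single a]
      · have h1 := hform a a
        have h2 : (B.form (x a) (x a) : ℚ) ≠ 0 := by exact_mod_cast (hpos a).ne'
        have h3 : B.bilQ (v a) (v a) ≠ 0 := by
          intro h; rw [h, mul_zero] at h1; exact h2 h1
        have h4 := hm' a
        rw [h1]; field_simp
      · intro i _ hia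
        rw [hort i a hia]; simp
      · simp
    intro u u'
    conv_lhs => rw [hF]
    simp only [F, LinearMap.BilinForm.sum_apply, LinearMap.smul_apply,
      LinearMap.BilinForm.linMulLin_apply, smul_eq_mul]
    refine Finset.sum_congr rfl fun i _ => ?_
    rw [B.bilQ_symm u, B.bilQ_symm u']
    ring

namespace OrthoFrame

variable {B : PosDefEvenForm L} (F : OrthoFrame B)

/-- The norms `β(wᵢ, wᵢ)` of the vectors of the frame. -/
def N (i : Fin (Module.finrank ℤ L)) : ℤ := B.form (F.w i) (F.w i)

theorem N_pos (i) : 0 < F.N i := F.pos i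

theorem N_real_pos (i) : (0 : ℝ) < F.N i := by exact_mod_cast F.pos i

theorem N_ne_zero (i) : (F.N i : ℂ) ≠ 0 := by exact_mod_cast (F.pos i).ne'

/-- The coordinates of a vector of `L ⊗ ℂ` with respect to the frame. -/
def coordC (z : ℂ ⊗[ℤ] L) (i : Fin (Module.finrank ℤ L)) : ℂ :=
  B.bilC z (inclC L (F.w i)) / F.N i

theorem parsevalC (z z' : ℂ ⊗[ℤ] L) :
    B.bilC z z' = ∑ i, F.N i * F.coordC z i * F.coordC z' i := by
  have h0 := F.N_ne_zero
  induction z using TensorProduct.induction_on with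
  | zero => simp [coordC]
  | add v v' h h' =>
    simp only [map_add, LinearMap.add_apply, h, h', coordC, ← Finset.sum_add_distrib]
    exact Finset.sum_congr rfl fun i _ => by ring
  | tmul a x =>
    induction z' using TensorProduct.induction_on with
    | zero => simp [coordC]
    | add v v' h h' =>
      simp only [map_add, LinearMap.add_apply, h, h', coordC, ← Finset.sum_add_distrib]
      exact Finset.sum_congr rfl fun i _ => by ring
    | tmul b y =>
      have h1 : ∀ (a : ℂ) (x : L), a ⊗ₜ[ℤ] x = a • inclC L x := fun a x => by
        rw [inclC_apply, TensorProduct.smul_tmul', smul_eq_mul, mul_one]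
      have h2 := F.parseval (inclQ L x) (inclQ L y)
      simp only [B.bilQ_incl] at h2
      have h3 : (B.form x y : ℂ) =
          ∑ i, (B.form x (F.w i) : ℂ) * B.form y (F.w i) / F.N i := by
        exact_mod_cast congrArg (fun q : ℚ => (q : ℂ)) h2
      simp only [coordC, h1 _ x, h1 _ y, map_smul, LinearMap.smul_apply, smul_eq_mul, B.bilC_incl]
      rw [h3, Finset.mul_sum, Finset.mul_sum]
      refine Finset.sum_congr rfl fun i _ => ?_
      have := h0 i
      field_simp

theorem coordC_add (z z' : ℂ ⊗[ℤ] L) (i) : F.coordC (z + z') i = F.coordC z i + F.coordC z' i := by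
  simp only [coordC, map_add, LinearMap.add_apply]; ring

theorem quadC_eq (z : ℂ ⊗[ℤ] L) : B.quadC z = ∑ i, F.N i * F.coordC z i ^ 2 / 2 := by
  rw [PosDefEvenForm.quadC, F.parsevalC, Finset.sum_div]
  exact Finset.sum_congr rfl fun i _ => by ring

/-- The integers `β(r, wᵢ)`, for `r` in the dual lattice. -/
def dualCoord (r : B.dual) (i : Fin (Module.finrank ℤ L)) : ℤ :=
  ((B.mem_dual r).1 r.2 (F.w i)).choose

theorem dualCoord_spec (r : B.dual) (i) :
    B.bilQ r (inclQ L (F.w i)) = F.dualCoord r i :=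
  ((B.mem_dual r).1 r.2 (F.w i)).choose_spec

theorem eq_of_bilQ_eq {v v' : ℚ ⊗[ℤ] L}
    (h : ∀ i, B.bilQ v (inclQ L (F.w i)) = B.bilQ v' (inclQ L (F.w i))) : v = v' := by
  rw [← sub_eq_zero]
  refine B.eq_zero_of_bilQ_incl _ fun x => ?_
  rw [F.parseval]
  exact Finset.sum_eq_zero fun i _ => by simp [h i]

theorem dualCoord_injective : Function.Injective F.dualCoord := by
  intro r r' h
  refine Subtype.ext (F.eq_of_bilQ_eq fun i => ?_)
  rw [F.dualCoord_spec, F.dualCoord_spec, h]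

/-- The term with index `k` of the theta series of the lattice dual to the span of the frame, in
coordinates. -/
def boxTerm (τ : ℍ) (t : Fin (Module.finrank ℤ L) → ℂ) (k : Fin (Module.finrank ℤ L) → ℤ) : ℂ :=
  ∏ i, jacobiTheta₂_term (k i) (t i) ((τ : ℂ) / ((F.N i : ℝ) : ℂ))

theorem summable_boxTerm (τ : ℍ) (t : Fin (Module.finrank ℤ L) → ℂ) :
    Summable fun k => ‖F.boxTerm τ t k‖ :=
  (hasSum_pi_prod (fun i m => jacobiTheta₂_term m (t i) ((τ : ℂ) / ((F.N i : ℝ) : ℂ))) fun i =>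
    summable_norm_jacobiTheta₂_term _ (im_div_ofReal_pos τ (F.N_real_pos i))).1

theorem coordC_ratToC (r : B.dual) (i) :
    F.coordC (ratToC L r) i = F.dualCoord r i / F.N i := by
  rw [coordC, ← ratToC_incl, B.bilC_ratToC, F.dualCoord_spec, Rat.cast_intCast]

theorem boxTerm_eq_e (τ : ℍ) (t : Fin (Module.finrank ℤ L) → ℂ) (k) :
    F.boxTerm τ t k = e (τ * ∑ i, (k i : ℂ) ^ 2 / (2 * F.N i) + ∑ i, k i * t i) := by
  rw [boxTerm, e]
  simp only [jacobiTheta₂_term]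
  rw [← Complex.exp_sum, Finset.mul_sum, ← Finset.sum_add_distrib, Finset.mul_sum]
  congr 1
  refine Finset.sum_congr rfl fun i _ => ?_
  have := F.N_ne_zero i
  push_cast
  field_simp
  ring

theorem thetaTerm_eq_boxTerm (r : B.dual) (τ : ℍ) (z : ℂ ⊗[ℤ] L) :
    B.thetaTerm r τ z = F.boxTerm τ (F.coordC z) (F.dualCoord r) := by
  rw [F.boxTerm_eq_e, PosDefEvenForm.thetaTerm, ← B.quadC_ratToC, F.quadC_eq, F.parsevalC]
  simp only [F.coordC_ratToC]
  have h1 : ∀ i, F.N i * ((F.dualCoord r i : ℂ) / F.N i) ^ 2 / 2 =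
      (F.dualCoord r i : ℂ) ^ 2 / (2 * F.N i) := fun i => by
    have := F.N_ne_zero i
    field_simp
  have h2 : ∀ i, F.N i * ((F.dualCoord r i : ℂ) / F.N i) * F.coordC z i =
      F.dualCoord r i * F.coordC z i := fun i => by
    rw [mul_div_cancel₀ _ (F.N_ne_zero i)]
  simp only [h1, h2]

theorem summable_thetaTerm (F : OrthoFrame B) (τ : ℍ) (z : ℂ ⊗[ℤ] L) :
    Summable fun r : B.dual => ‖B.thetaTerm r τ z‖ := by
  simp only [F.thetaTerm_eq_boxTerm]
  exact (F.summable_boxTerm τ (F.coordC z)).comp_injective F.dualCoord_injective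

/-- Poisson summation for the lattice spanned by the frame. -/
theorem hasSum_boxGaussian (τ : ℍ) (t : Fin (Module.finrank ℤ L) → ℂ) :
    HasSum (fun m : Fin (Module.finrank ℤ L) → ℤ =>
        e (-(∑ i, F.N i * (m i + t i) ^ 2 / 2) / τ))
      (((∏ i, (F.N i : ℝ) ^ (-(1 / 2) : ℝ) : ℝ) : ℂ) *
        ((-Complex.I * τ) ^ (1 / 2 : ℂ)) ^ Module.finrank ℤ L * ∑' k, F.boxTerm τ t k) := by
  have h1 := hasSum_pi_prod
    (fun i (m : ℤ) => Complex.exp (-Real.pi * Complex.I * (F.N i : ℝ) * (m + t i) ^ 2 / τ))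
    fun i => (hasSum_gaussian τ (t i) (F.N_real_pos i)).1
  have h2 := hasSum_pi_prod (fun i m => jacobiTheta₂_term m (t i) ((τ : ℂ) / ((F.N i : ℝ) : ℂ)))
    fun i => summable_norm_jacobiTheta₂_term _ (im_div_ofReal_pos τ (F.N_real_pos i))
  convert h1.2 using 1
  · funext m
    rw [← Complex.exp_sum, e]
    congr 1
    rw [← Finset.sum_neg_distrib, Finset.sum_div, Finset.mul_sum]
    refine Finset.sum_congr rfl fun i _ => ?_
    push_cast
    ring
  · rw [Finset.prod_congr rfl fun i _ => (hasSum_gaussian τ (t i) (F.N_real_pos i)).2.tsum_eq,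
      Finset.prod_mul_distrib, Finset.prod_mul_distrib, Finset.prod_const, Finset.card_univ,
      Fintype.card_fin, Complex.ofReal_prod]
    congr 1
    exact h2.2.tsum_eq

end OrthoFrame

/-! ### Characters of the discriminant group -/

theorem e_eq_one_iff (w : ℂ) : e w = 1 ↔ ∃ n : ℤ, w = n := by
  rw [e, Complex.exp_eq_one_iff]
  refine exists_congr fun n => ?_
  rw [mul_comm (n : ℂ), mul_right_inj' Complex.two_pi_I_ne_zero]

theorem e_ne_zero (w : ℂ) : e w ≠ 0 := Complex.exp_ne_zero _

theorem e_zero : e 0 = 1 := by simp [e]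

theorem norm_e_ratCast (q : ℚ) : ‖e (q : ℂ)‖ = 1 := by
  rw [e, Complex.norm_exp]
  simp

/-- The character `q + ℤ ↦ e(q)` of `ℚ/ℤ`. -/
def ratChar : AddChar (AddCircle (1 : ℚ)) ℂ where
  toFun := Quotient.lift (fun q : ℚ => e (q : ℂ)) fun a b h => by
    obtain ⟨n, hn⟩ := AddSubgroup.mem_zmultiples_iff.1 (QuotientAddGroup.leftRel_apply.1 h)
    refine e_eq_of_sub_int (-n) ?_
    have h1 : (n : ℚ) = -a + b := by simpa using hn
    have h2 : (n : ℂ) = -a + b := by exact_mod_cast congrArg (fun q : ℚ => (q : ℂ)) h1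
    push_cast
    rw [h2]; ring
  map_zero_eq_one' := by
    change e ((0 : ℚ) : ℂ) = 1
    rw [Rat.cast_zero, e_zero]
  map_add_eq_mul' a b := by
    induction a using QuotientAddGroup.induction_on with
    | H a =>
      induction b using QuotientAddGroup.induction_on with
      | H b =>
        change e ((a + b : ℚ) : ℂ) = e a * e b
        rw [Rat.cast_add, e_add]

theorem ratChar_coe (q : ℚ) : ratChar (q : AddCircle (1 : ℚ)) = e q := rfl

theorem coe_eq_zero_iff_int (q : ℚ) : (q : AddCircle (1 : ℚ)) = 0 ↔ ∃ n : ℤ, q = n := by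
  rw [AddCircle.coe_eq_zero_iff]
  exact exists_congr fun n => by rw [zsmul_one, eq_comm]

theorem ratChar_eq_one_iff (t : AddCircle (1 : ℚ)) : ratChar t = 1 ↔ t = 0 := by
  induction t using QuotientAddGroup.induction_on with
  | H q =>
    change e (q : ℂ) = 1 ↔ _
    rw [e_eq_one_iff, coe_eq_zero_iff_int]
    exact exists_congr fun n => by exact_mod_cast Iff.rfl

theorem star_ratChar (t : AddCircle (1 : ℚ)) : star (ratChar t) = ratChar (-t) := by
  have hn : ‖ratChar t‖ = 1 := by
    induction t using QuotientAddGroup.induction_on with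
    | H q => exact norm_e_ratCast q
  rw [AddChar.map_neg_eq_inv, Complex.inv_eq_conj hn]; rfl

/-- The sum of the powers of a root of unity whose order divides `N`. -/
theorem sum_ratChar_nsmul {N : ℕ} {t : AddCircle (1 : ℚ)} (h : N • t = 0) :
    ∑ l ∈ Finset.range N, ratChar (l • t) = if t = 0 then (N : ℂ) else 0 := by
  split_ifs with ht
  · simp [ht]
  · have h1 : ratChar t ≠ 1 := fun h1 => ht ((ratChar_eq_one_iff t).1 h1)
    simp only [AddChar.map_nsmul_eq_pow]
    rw [geom_sum_eq h1, ← AddChar.map_nsmul_eq_pow, h, AddChar.map_zero_eq_one, sub_self, zero_div]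

namespace PosDefEvenForm

variable (B : PosDefEvenForm L)

theorem discBil_symm (a b : B.Disc) : B.discBil a b = B.discBil b a := by
  induction a using QuotientAddGroup.induction_on with
  | H r =>
    induction b using QuotientAddGroup.induction_on with
    | H s => rw [discBil_cls, discBil_cls, bilQ_symm]

theorem discBil_add_right (a b c : B.Disc) :
    B.discBil a (b + c) = B.discBil a b + B.discBil a c := by
  induction a using QuotientAddGroup.induction_on with
  | H r =>
    induction b using QuotientAddGroup.induction_on with
    | H s =>
      induction c using QuotientAddGroup.induction_on with
      | H t =>
        rw [← QuotientAddGroup.mk_add, discBil_cls, discBil_cls, discBil_cls, AddSubgroup.coe_add,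
          map_add, AddCircle.coe_add]

/-- The bilinear form on the discriminant group as a homomorphism in the second variable. -/
def discBilHom (a : B.Disc) : B.Disc →+ AddCircle (1 : ℚ) where
  toFun := B.discBil a
  map_zero' := by simpa using B.discBil_add_right a 0 0
  map_add' := B.discBil_add_right a

theorem discBil_zero_right (a : B.Disc) : B.discBil a 0 = 0 := map_zero (B.discBilHom a)

theorem discBil_neg_right (a b : B.Disc) : B.discBil a (-b) = -B.discBil a b :=
  map_neg (B.discBilHom a) b

theorem discBil_sub_right (a b c : B.Disc) :
    B.discBil a (b - c) = B.discBil a b - B.discBil a c := map_sub (B.discBilHom a) b c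

theorem discBil_nsmul_right (a b : B.Disc) (n : ℕ) : B.discBil a (n • b) = n • B.discBil a b :=
  map_nsmul (B.discBilHom a) n b

theorem discQuad_add (a b : B.Disc) :
    B.discQuad (a + b) = B.discQuad a + B.discQuad b + B.discBil a b := by
  induction a using QuotientAddGroup.induction_on with
  | H r =>
    induction b using QuotientAddGroup.induction_on with
    | H s =>
      rw [← QuotientAddGroup.mk_add, discQuad_cls, discQuad_cls, discQuad_cls, discBil_cls,
        AddSubgroup.coe_add, quadQ_add, AddCircle.coe_add, AddCircle.coe_add]

theorem discBil_self_of_isotropic {x : B.Disc} (hx : B.discQuad x = 0) : B.discBil x x = 0 := by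
  induction x using QuotientAddGroup.induction_on with
  | H r =>
    rw [discQuad_cls, coe_eq_zero_iff_int] at hx
    rw [discBil_cls, coe_eq_zero_iff_int]
    obtain ⟨n, hn⟩ := hx
    refine ⟨2 * n, ?_⟩
    rw [quadQ] at hn
    push_cast
    linarith

theorem discQuad_nsmul_of_isotropic {x : B.Disc} (hx : B.discQuad x = 0) (l : ℕ) :
    B.discQuad (l • x) = 0 := by
  induction l with
  | zero =>
    rw [zero_nsmul, show (0 : B.Disc) = B.cls 0 from rfl, discQuad_cls]
    simp [quadQ]
  | succ l ih =>
    rw [succ_nsmul, discQuad_add, ih, hx, discBil_symm, discBil_nsmul_right,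
      B.discBil_self_of_isotropic hx]
    simp

theorem discQuad_add_nsmul {x y : B.Disc} (hx : B.discQuad x = 0) (hxy : B.discBil x y = 0)
    (l : ℕ) : B.discQuad (y + l • x) = B.discQuad y := by
  rw [discQuad_add, B.discQuad_nsmul_of_isotropic hx, discBil_nsmul_right, B.discBil_symm y x, hxy]
  simp

theorem eq_zero_of_inclQ (B : PosDefEvenForm L) {x : L} (hx : inclQ L x = 0) : x = 0 := by
  by_contra hne
  have h := B.bilQ_incl x x
  rw [hx, map_zero] at h
  exact (B.pos x hne).ne' (by exact_mod_cast h.symm)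

/-- The discriminant form is nondegenerate: the bidual of `L` is `L`. -/
theorem discBil_nondegenerate [Module.Free ℤ L] [Module.Finite ℤ L] {a : B.Disc}
    (h : ∀ b, B.discBil a b = 0) : a = 0 := by
  induction a using QuotientAddGroup.induction_on with
  | H r =>
    let b₀ := Module.Free.chooseBasis ℤ L
    let b := Algebra.TensorProduct.basis ℚ b₀
    have hb : ∀ i, b i = inclQ L (b₀ i) := fun i => Algebra.TensorProduct.basis_apply _ _
    have hnd : B.bilQ.Nondegenerate :=
      ⟨fun v hv => B.eq_zero_of_bilQ_incl v fun x => hv _,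
        fun v hv => B.eq_zero_of_bilQ_incl v fun x => by rw [B.bilQ_symm, hv]⟩
    have hdual : ∀ i, B.bilQ.dualBasis hnd b i ∈ B.dual := by
      intro i x
      have hx : x ∈ Submodule.span ℤ (Set.range b₀) := by rw [b₀.span_eq]; trivial
      induction hx using Submodule.span_induction with
      | mem x hx =>
        obtain ⟨j, rfl⟩ := hx
        rw [← hb, LinearMap.BilinForm.apply_dualBasis_left]
        split_ifs
        exacts [⟨1, by simp⟩, ⟨0, by simp⟩]
      | zero => exact ⟨0, by simp⟩
      | add x y _ _ hx hy =>
        obtain ⟨n, hn⟩ := hx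
        obtain ⟨m, hm⟩ := hy
        exact ⟨n + m, by simp [hn, hm]⟩
      | smul c x _ hx =>
        obtain ⟨n, hn⟩ := hx
        exact ⟨c * n, by rw [map_zsmul, map_zsmul, hn]; simp⟩
    have hint : ∀ i, ∃ n : ℤ, B.bilQ (B.bilQ.dualBasis hnd b i) r = n := by
      intro i
      have := h (B.cls ⟨_, hdual i⟩)
      rw [discBil_cls, coe_eq_zero_iff_int] at this
      rwa [B.bilQ_symm]
    choose n hn using hint
    rw [QuotientAddGroup.eq_zero_iff, mem_sub]
    refine ⟨∑ i, n i • b₀ i, ?_⟩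
    conv_rhs => rw [← b.sum_repr (r : ℚ ⊗[ℤ] L)]
    rw [map_sum]
    refine Finset.sum_congr rfl fun i _ => ?_
    have h1 : b.repr (r : ℚ ⊗[ℤ] L) i = n i := by
      rw [← hn i]
      conv_rhs => rw [← b.sum_repr (r : ℚ ⊗[ℤ] L)]
      simp only [map_sum, map_smul, LinearMap.BilinForm.apply_dualBasis_left, smul_eq_mul]
      simp
    rw [map_zsmul, h1, hb, Int.cast_smul_eq_zsmul]

/-- Orthogonality of the characters `ratChar (β(a, ·))` of the discriminant group. -/
theorem sum_ratChar_discBil [Module.Free ℤ L] [Module.Finite ℤ L] (a : B.Disc) [Decidable (a = 0)] :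
    ∑ b, ratChar (B.discBil a b) = if a = 0 then (Fintype.card B.Disc : ℂ) else 0 := by
  classical
  have h := AddChar.sum_eq_ite (ratChar.compAddMonoidHom (B.discBilHom a))
  have h0 : ratChar.compAddMonoidHom (B.discBilHom a) = 0 ↔ a = 0 := by
    constructor
    · intro h0
      refine B.discBil_nondegenerate fun b => (ratChar_eq_one_iff _).1 ?_
      exact DFunLike.congr_fun h0 b
    · rintro rfl
      ext b
      change ratChar (B.discBil 0 b) = 1
      rw [discBil_symm, discBil_zero_right, AddChar.map_zero_eq_one]
  simp only [h0] at h
  exact h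

end PosDefEvenForm

/-! ### Summation over fibres -/

theorem hasSum_of_fiberwise {α β : Type*} [Fintype β] (π : α → β) (f : α → ℂ) (a : β → ℂ)
    (h : ∀ b, HasSum (fun x : {x // π x = b} => f x) (a b)) : HasSum f (∑ b, a b) := by
  classical
  have h1 : ∀ b ∈ Finset.univ, HasSum (Set.indicator {x | π x = b} f) (a b) := fun b _ =>
    hasSum_subtype_iff_indicator.1 (h b)
  convert hasSum_sum h1 using 1
  funext x
  rw [Finset.sum_eq_single (π x)]
  · rw [Set.indicator_of_mem (by exact rfl)]
  · intro b _ hb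
    exact Set.indicator_of_notMem (fun h => hb h.symm) _
  · simp

/-- The bijection onto a fibre given by an injective map whose image is this fibre. -/
def fiberEquiv {α β γ : Type*} {π : α → β} {b : β} (g : γ → α) (hg : Function.Injective g)
    (hr : ∀ x, π x = b ↔ ∃ c, g c = x) : γ ≃ {x // π x = b} :=
  Equiv.ofBijective (fun c => ⟨g c, (hr _).2 ⟨c, rfl⟩⟩)
    ⟨fun _ _ h => hg (congrArg Subtype.val h), fun ⟨x, hx⟩ => by
      obtain ⟨c, rfl⟩ := (hr x).1 hx
      exact ⟨c, rfl⟩⟩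

theorem fiberEquiv_apply {α β γ : Type*} {π : α → β} {b : β} (g : γ → α)
    (hg : Function.Injective g) (hr : ∀ x, π x = b ↔ ∃ c, g c = x) (c : γ) :
    (fiberEquiv g hg hr c : α) = g c := rfl

/-! ### Poisson summation over the lattice -/

namespace OrthoFrame

variable {B : PosDefEvenForm L} (F : OrthoFrame B)

/-- The vector of `L` with given integral coordinates with respect to the frame. -/
def vec : (Fin (Module.finrank ℤ L) → ℤ) →+ L where
  toFun m := ∑ i, m i • F.w i
  map_zero' := by simp
  map_add' m m' := by simp [add_smul, Finset.sum_add_distrib]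

theorem form_vec (m : Fin (Module.finrank ℤ L) → ℤ) (i) :
    B.form (F.vec m) (F.w i) = m i * F.N i := by
  simp only [vec, AddMonoidHom.coe_mk, ZeroHom.coe_mk, map_sum, map_smul, LinearMap.sum_apply,
    LinearMap.smul_apply, smul_eq_mul]
  rw [Finset.sum_eq_single i]
  · rfl
  · intro j _ hj
    rw [F.ortho j i hj, mul_zero]
  · simp

theorem coordC_vec (m : Fin (Module.finrank ℤ L) → ℤ) (i) :
    F.coordC (inclC L (F.vec m)) i = m i := by
  rw [coordC, B.bilC_incl, form_vec]
  push_cast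
  rw [mul_div_cancel_right₀ _ (F.N_ne_zero i)]

theorem vec_injective : Function.Injective F.vec := by
  intro m m' h
  funext i
  have := congrArg (fun x => B.form x (F.w i)) h
  simp only [form_vec] at this
  exact mul_right_cancel₀ (F.N_pos i).ne' this

theorem eq_of_form_eq {x y : L} (h : ∀ i, B.form x (F.w i) = B.form y (F.w i)) : x = y := by
  rw [← sub_eq_zero]
  refine B.eq_zero_of_inclQ ?_
  rw [map_sub, sub_eq_zero]
  exact F.eq_of_bilQ_eq fun i => by rw [B.bilQ_incl, B.bilQ_incl, h]

theorem finite_quotient [Module.Finite ℤ L] : Finite (L ⧸ F.vec.range) := by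
  have hfin : Module.Finite ℤ (L ⧸ F.vec.range) :=
    Module.Finite.of_surjective (QuotientAddGroup.mk' F.vec.range).toIntLinearMap
      (QuotientAddGroup.mk'_surjective _)
  refine Module.finite_of_fg_torsion _ fun {q} => ?_
  obtain ⟨x, rfl⟩ := QuotientAddGroup.mk_surjective q
  refine ⟨⟨∏ i, F.N i, mem_nonZeroDivisors_of_ne_zero
    (Finset.prod_ne_zero_iff.2 fun i _ => (F.N_pos i).ne')⟩, ?_⟩
  change (∏ i, F.N i) • (QuotientAddGroup.mk x : L ⧸ F.vec.range) = 0
  rw [← QuotientAddGroup.mk_zsmul, QuotientAddGroup.eq_zero_iff]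
  refine ⟨fun i => B.form x (F.w i) * ∏ j ∈ Finset.univ.erase i, F.N j, ?_⟩
  refine F.eq_of_form_eq fun i => ?_
  rw [form_vec, map_zsmul, LinearMap.smul_apply, smul_eq_mul,
    ← Finset.mul_prod_erase _ _ (Finset.mem_univ i)]
  ring

/-- A vector of integers consists of the coordinates `β(r, wᵢ)` of an element `r` of the dual
lattice if and only if it is integral on `L`. -/
theorem exists_dualCoord_iff (k : Fin (Module.finrank ℤ L) → ℤ) :
    (∃ r : B.dual, F.dualCoord r = k) ↔ ∀ x : L, e (∑ i, k i * F.coordC (inclC L x) i) = 1 := by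
  have key : ∀ (v : ℚ ⊗[ℤ] L), (∀ i, B.bilQ v (inclQ L (F.w i)) = k i) → ∀ x : L,
      ∑ i, k i * F.coordC (inclC L x) i = (B.bilQ v (inclQ L x) : ℂ) := by
    intro v hv x
    rw [F.parseval]
    push_cast
    refine Finset.sum_congr rfl fun i _ => ?_
    rw [hv, B.bilQ_incl, coordC, B.bilC_incl, N]
    push_cast
    ring
  constructor
  · rintro ⟨r, rfl⟩ x
    obtain ⟨n, hn⟩ := (B.mem_dual r).1 r.2 x
    rw [key r (F.dualCoord_spec r) x, hn, Rat.cast_intCast, e_intCast]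
  · intro h
    let v : ℚ ⊗[ℤ] L := ∑ i, ((k i : ℚ) / F.N i) • inclQ L (F.w i)
    have hv : ∀ i, B.bilQ v (inclQ L (F.w i)) = k i := by
      intro i
      simp only [v, map_sum, map_smul, LinearMap.sum_apply, LinearMap.smul_apply, B.bilQ_incl,
        smul_eq_mul]
      rw [Finset.sum_eq_single i]
      · exact div_mul_cancel₀ _ (by exact_mod_cast (F.N_pos i).ne')
      · intro j _ hj
        rw [F.ortho j i hj, Int.cast_zero, mul_zero]
      · simp
    have hd : v ∈ B.dual := by
      intro x
      have := h x
      rw [key v hv, e_eq_one_iff] at this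
      obtain ⟨n, hn⟩ := this
      exact ⟨n, by exact_mod_cast hn⟩
    refine ⟨⟨v, hd⟩, funext fun i => ?_⟩
    have h1 := F.dualCoord_spec ⟨v, hd⟩ i
    rw [hv] at h1
    exact_mod_cast h1.symm

/-- The character `x ↦ e(∑ kᵢ xᵢ)` of `L` modulo the span of the frame. -/
def quotChar (k : Fin (Module.finrank ℤ L) → ℤ) : AddChar (L ⧸ F.vec.range) ℂ where
  toFun := Quotient.lift (fun x => e (∑ i, k i * F.coordC (inclC L x) i)) fun a b h => by
    obtain ⟨m, hm⟩ := QuotientAddGroup.leftRel_apply.1 h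
    have hb : b = a + F.vec m := by rw [hm]; abel
    refine e_eq_of_sub_int (-∑ i, k i * m i) ?_
    simp only [hb, map_add, coordC_add, coordC_vec, mul_add, Finset.sum_add_distrib]
    push_cast
    ring
  map_zero_eq_one' := by
    change e (∑ i, k i * F.coordC (inclC L 0) i) = 1
    simp [coordC, e_zero]
  map_add_eq_mul' a b := by
    induction a using QuotientAddGroup.induction_on with
    | H a =>
      induction b using QuotientAddGroup.induction_on with
      | H b =>
        change e (∑ i, k i * F.coordC (inclC L (a + b)) i) =
          e (∑ i, k i * F.coordC (inclC L a) i) * e (∑ i, k i * F.coordC (inclC L b) i)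
        simp only [map_add, coordC_add, mul_add, Finset.sum_add_distrib, e_add]

theorem quotChar_mk (k : Fin (Module.finrank ℤ L) → ℤ) (x : L) :
    F.quotChar k (x : L ⧸ F.vec.range) = e (∑ i, k i * F.coordC (inclC L x) i) := rfl

theorem boxTerm_add (τ : ℍ) (z : ℂ ⊗[ℤ] L) (x : L) (k) :
    F.boxTerm τ (F.coordC (inclC L x + z)) k =
      F.quotChar k (x : L ⧸ F.vec.range) * F.boxTerm τ (F.coordC z) k := by
  rw [F.boxTerm_eq_e, F.boxTerm_eq_e, quotChar_mk, ← e_add]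
  simp only [coordC_add, mul_add, Finset.sum_add_distrib]
  congr 1
  ring

/-- The constant in Poisson summation over `L`. It is the inverse of the covolume of `L`. -/
def poissonConst : ℝ :=
  (∏ i, (F.N i : ℝ) ^ (-(1 / 2) : ℝ)) * Nat.card (L ⧸ F.vec.range)

theorem poissonConst_pos [Module.Finite ℤ L] : 0 < F.poissonConst := by
  have := F.finite_quotient
  refine mul_pos (Finset.prod_pos fun i _ => Real.rpow_pos_of_pos (F.N_real_pos i) _) ?_
  exact_mod_cast Nat.card_pos

/-- Poisson summation for a Gaussian on `L`. It follows from the case of the orthogonal sublattice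
spanned by the frame: the sum over the cosets of this sublattice singles out, in its dual, the
elements of the dual of `L`. -/
theorem hasSum_gaussian_lattice [Module.Finite ℤ L] (τ : ℍ) (u : ℂ ⊗[ℤ] L) :
    HasSum (fun x : L => e (-B.quadC (inclC L x + u) / τ))
      (F.poissonConst * ((-Complex.I * τ) ^ (1 / 2 : ℂ)) ^ Module.finrank ℤ L *
        ∑' s : B.dual, B.thetaTerm s τ u) := by
  classical
  have := F.finite_quotient
  have := Fintype.ofFinite (L ⧸ F.vec.range)
  have hmain : HasSum (fun x : L => e (-B.quadC (inclC L x + u) / τ))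
      (∑ q : L ⧸ F.vec.range, (((∏ i, (F.N i : ℝ) ^ (-(1 / 2) : ℝ) : ℝ) : ℂ) *
        ((-Complex.I * τ) ^ (1 / 2 : ℂ)) ^ Module.finrank ℤ L *
          ∑' k, F.quotChar k q * F.boxTerm τ (F.coordC u) k)) := by
    refine hasSum_of_fiberwise (fun x : L => (x : L ⧸ F.vec.range)) _ _ fun q => ?_
    induction q using QuotientAddGroup.induction_on with
    | H c =>
      have hr : ∀ x : L, (x : L ⧸ F.vec.range) = c ↔ ∃ m, c + F.vec m = x := by
        intro x
        rw [eq_comm, QuotientAddGroup.eq]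
        exact exists_congr fun m => ⟨fun h => by rw [h]; abel, fun h => by rw [← h]; abel⟩
      have hinj : Function.Injective fun m => c + F.vec m :=
        fun m m' h => F.vec_injective (add_left_cancel h)
      rw [← (fiberEquiv _ hinj hr).hasSum_iff]
      have h1 := F.hasSum_boxGaussian τ (F.coordC (inclC L c + u))
      simp only [boxTerm_add] at h1
      refine h1.congr_fun fun m => ?_
      simp only [Function.comp_apply, fiberEquiv_apply]
      congr 3
      rw [F.quadC_eq]
      refine Finset.sum_congr rfl fun i _ => ?_
      rw [map_add, add_right_comm, coordC_add, coordC_vec, add_comm]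
  convert hmain using 1
  have hs : ∀ q, Summable fun k => F.quotChar k q * F.boxTerm τ (F.coordC u) k := by
    intro q
    induction q using QuotientAddGroup.induction_on with
    | H c =>
      simp only [← boxTerm_add]
      exact (F.summable_boxTerm _ _).of_norm
  rw [← Finset.mul_sum, ← Summable.tsum_finsetSum fun q _ => hs q]
  have h2 : ∀ k, ∑ q, F.quotChar k q * F.boxTerm τ (F.coordC u) k =
      Nat.card (L ⧸ F.vec.range) *
        Set.indicator (Set.range F.dualCoord) (F.boxTerm τ (F.coordC u)) k := by
    intro k
    rw [← Finset.sum_mul, AddChar.sum_eq_ite]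
    have h0 : F.quotChar k = 0 ↔ k ∈ Set.range F.dualCoord := by
      rw [Set.mem_range, F.exists_dualCoord_iff]
      constructor
      · intro h x
        exact DFunLike.congr_fun h (x : L ⧸ F.vec.range)
      · intro h
        ext q
        induction q using QuotientAddGroup.induction_on with
        | H c => exact h c
    by_cases hk : k ∈ Set.range F.dualCoord
    · rw [if_pos (h0.2 hk), Set.indicator_of_mem hk, Nat.card_eq_fintype_card]
    · rw [if_neg (fun h => hk (h0.1 h)), Set.indicator_of_notMem hk, zero_mul, mul_zero]
  simp only [h2]
  rw [tsum_mul_left, ← tsum_subtype, tsum_range _ F.dualCoord_injective]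
  simp only [← F.thetaTerm_eq_boxTerm]
  rw [poissonConst]
  push_cast
  ring

end OrthoFrame

/-! ### Linear independence of the theta series -/

section

/-- The measure of the circle `ℝ/ℤ` with which the Fourier monomials are orthonormal. -/
local instance : MeasureTheory.MeasureSpace UnitAddCircle := ⟨AddCircle.haarAddCircle⟩

local instance : MeasureTheory.IsProbabilityMeasure
    (MeasureTheory.volume : MeasureTheory.Measure UnitAddCircle) :=
  inferInstanceAs (MeasureTheory.IsProbabilityMeasure AddCircle.haarAddCircle)

/-- Uniqueness of the coefficients of an absolutely convergent Fourier series on a torus. -/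
theorem eq_zero_of_fourier_eq_zero {n : ℕ} {α : Type*} (κ : α → Fin n → ℤ)
    (hκ : Function.Injective κ) (a : α → ℂ) (ha : Summable fun s => ‖a s‖)
    (h : ∀ v : Fin n → ℝ, ∑' s, a s * e (∑ i, κ s i * v i) = 0) (s : α) : a s = 0 := by
  classical
  have hS : Summable fun s => a s • UnitAddTorus.mFourier (κ s) := by
    refine Summable.of_norm ?_
    simpa [norm_smul, UnitAddTorus.mFourier_norm] using ha
  have h0 : ∑' s, a s • UnitAddTorus.mFourier (κ s) = 0 := by
    ext p
    obtain ⟨v, rfl⟩ : ∃ v : Fin n → ℝ, (fun i => (v i : UnitAddCircle)) = p := by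
      choose v hv using fun i => QuotientAddGroup.mk_surjective (p i)
      exact ⟨v, funext hv⟩
    rw [← ContinuousMap.tsum_apply hS, ContinuousMap.zero_apply, ← h v]
    refine tsum_congr fun s => ?_
    rw [ContinuousMap.smul_apply, smul_eq_mul]
    congr 1
    simp only [UnitAddTorus.mFourier, ContinuousMap.coe_mk, fourier_coe_apply]
    rw [← Complex.exp_sum, e, Finset.mul_sum]
    congr 1
    refine Finset.sum_congr rfl fun i _ => ?_
    push_cast
    ring
  have h1 := hS.hasSum
  rw [h0] at h1
  have h2 := h1.mapL ((innerSL ℂ (UnitAddTorus.mFourierLp 2 (κ s))).comp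
    (ContinuousMap.toLp (E := ℂ) 2 (MeasureTheory.volume : MeasureTheory.Measure
      (UnitAddTorus (Fin n))) ℂ))
  have h3 := orthonormal_iff_ite.1 (UnitAddTorus.orthonormal_mFourier (d := Fin n))
  have h4 : ∀ s', ((innerSL ℂ (UnitAddTorus.mFourierLp 2 (κ s))).comp
    (ContinuousMap.toLp (E := ℂ) 2 (MeasureTheory.volume : MeasureTheory.Measure
      (UnitAddTorus (Fin n))) ℂ)) (a s' • UnitAddTorus.mFourier (κ s')) =
      if s' = s then a s else 0 := by
    intro s'
    rw [map_smul]
    change a s' • inner ℂ (UnitAddTorus.mFourierLp 2 (κ s)) (UnitAddTorus.mFourierLp 2 (κ s')) = _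
    rw [h3]
    by_cases hs : s' = s
    · subst hs; simp
    · rw [if_neg (fun h => hs (hκ h).symm), if_neg hs, smul_zero]
  simp only [h4, map_zero] at h2
  exact (hasSum_ite_eq s (a s)).unique h2

end

theorem OrthoFrame.exists_coordC {B : PosDefEvenForm L} (F : OrthoFrame B)
    (t : Fin (Module.finrank ℤ L) → ℂ) : ∃ z, F.coordC z = t := by
  refine ⟨∑ i, t i • inclC L (F.w i), funext fun i => ?_⟩
  simp only [OrthoFrame.coordC, map_sum, map_smul, LinearMap.sum_apply, LinearMap.smul_apply,
    B.bilC_incl, smul_eq_mul]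
  rw [Finset.sum_eq_single i]
  · exact mul_div_cancel_right₀ _ (F.N_ne_zero i)
  · intro j _ hj
    rw [F.ortho j i hj, Int.cast_zero, mul_zero]
  · simp

namespace PosDefEvenForm

variable (B : PosDefEvenForm L) [Module.Free ℤ L] [Module.Finite ℤ L]

theorem summable_thetaTerm (τ : ℍ) (z : ℂ ⊗[ℤ] L) :
    Summable fun r : B.dual => ‖B.thetaTerm r τ z‖ :=
  B.exists_orthoFrame.some.summable_thetaTerm τ z

theorem hasSum_theta (y : B.Disc) (τ : ℍ) (z : ℂ ⊗[ℤ] L) :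
    HasSum (fun r : {r : B.dual // B.cls r = y} => B.thetaTerm r τ z) (B.theta y τ z) :=
  ((B.summable_thetaTerm τ z).of_norm.subtype _).hasSum

theorem hasSum_cls_mul_thetaTerm (c : B.Disc → ℂ) (τ : ℍ) (z : ℂ ⊗[ℤ] L) :
    HasSum (fun r : B.dual => c (B.cls r) * B.thetaTerm r τ z) (∑ y, c y * B.theta y τ z) := by
  refine hasSum_of_fiberwise B.cls _ _ fun y => ?_
  refine ((B.hasSum_theta y τ z).mul_left (c y)).congr_fun fun r => ?_
  rw [r.2]

/-- For fixed `τ`, the theta series are linearly independent functions of `z`. -/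
theorem theta_linearIndependent (τ : ℍ) (c : B.Disc → ℂ)
    (h : ∀ z, ∑ y, c y * B.theta y τ z = 0) (y : B.Disc) : c y = 0 := by
  obtain ⟨F⟩ := B.exists_orthoFrame
  have hbox : ∀ t k, F.boxTerm τ t k = F.boxTerm τ 0 k * e (∑ i, k i * t i) := by
    intro t k
    rw [F.boxTerm_eq_e, F.boxTerm_eq_e, ← e_add]
    simp
  obtain ⟨r, rfl⟩ := QuotientAddGroup.mk_surjective y
  obtain ⟨C, hC⟩ : ∃ C, ∀ y, ‖c y‖ ≤ C :=
    ⟨∑ y, ‖c y‖, fun y => Finset.single_le_sum (fun _ _ => norm_nonneg _) (Finset.mem_univ y)⟩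
  have h0 := eq_zero_of_fourier_eq_zero F.dualCoord F.dualCoord_injective
    (fun s => c (B.cls s) * F.boxTerm τ 0 (F.dualCoord s)) ?_ ?_ r
  · refine (mul_eq_zero.1 h0).resolve_right ?_
    rw [F.boxTerm_eq_e]
    exact e_ne_zero _
  · refine Summable.of_nonneg_of_le (fun _ => norm_nonneg _) (fun s => ?_)
      (((F.summable_boxTerm τ 0).comp_injective F.dualCoord_injective).mul_left C)
    rw [norm_mul]
    exact mul_le_mul_of_nonneg_right (hC _) (norm_nonneg _)
  · intro v
    obtain ⟨z, hz⟩ := F.exists_coordC fun i => (v i : ℂ)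
    have h1 := B.hasSum_cls_mul_thetaTerm c τ z
    simp only [F.thetaTerm_eq_boxTerm] at h1
    simp only [hz, h z, hbox (fun i => (v i : ℂ)), ← mul_assoc] at h1
    exact h1.tsum_eq

end PosDefEvenForm

/-! ### Transformation of the theta series under the generators of `SL₂(ℤ)` -/

namespace PosDefEvenForm

variable (B : PosDefEvenForm L)

theorem slash_matrix (k : ℤ) (A : SL(2, ℤ)) (φ : ℍ → ℂ ⊗[ℤ] L → ℂ) :
    B.slash k ⟨A, 0, 0⟩ φ = B.slashSL k A φ := by
  funext τ z
  simp [slash, slashHeis, quadC, e_zero]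

theorem slashSL_mul (k : ℤ) (A A' : SL(2, ℤ)) (φ : ℍ → ℂ ⊗[ℤ] L → ℂ) :
    B.slashSL k (A * A') φ = B.slashSL k A' (B.slashSL k A φ) := by
  rw [← slash_matrix, ← slash_matrix, ← slash_matrix, ← slash_mul]
  congr 1
  ext1 <;> simp

theorem slashSL_one (k : ℤ) (φ : ℍ → ℂ ⊗[ℤ] L → ℂ) : B.slashSL k 1 φ = φ := by
  funext τ z
  have h0 : (1 : SL(2, ℤ)) 1 0 = 0 := by simp
  simp [slashSL, autFactor, h0, e_zero]

theorem slashSL_mul_sum {ι : Type*} (s : Finset ι) (k : ℤ) (A : SL(2, ℤ)) (c : ℍ → ℂ) (a : ι → ℂ)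
    (φ : ι → ℍ → ℂ ⊗[ℤ] L → ℂ) (τ : ℍ) (z : ℂ ⊗[ℤ] L) :
    B.slashSL k A (fun τ z => c τ * ∑ i ∈ s, a i * φ i τ z) τ z =
      c (A • τ) * ∑ i ∈ s, a i * B.slashSL k A (φ i) τ z := by
  simp only [slashSL, mul_assoc, Finset.sum_mul]

theorem slashSL_eq_mul (k : ℤ) (A : SL(2, ℤ)) (φ : ℍ → ℂ ⊗[ℤ] L → ℂ) (τ : ℍ) (z : ℂ ⊗[ℤ] L) :
    B.slashSL k A φ τ z = autFactor A τ ^ (-k) * B.slashSL 0 A φ τ z := by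
  simp only [slashSL, neg_zero, zpow_zero]
  ring

theorem coe_T_smul (τ : ℍ) : ((ModularGroup.T • τ : ℍ) : ℂ) = τ + 1 := by
  have h := autFactor_mul_smul ModularGroup.T τ
  simpa [autFactor, ModularGroup.coe_T] using h

theorem autFactor_S (τ : ℍ) : autFactor ModularGroup.S τ = τ := by
  simp [autFactor, ModularGroup.coe_S]

theorem coe_S_smul (τ : ℍ) : ((ModularGroup.S • τ : ℍ) : ℂ) = -1 / τ := by
  have h := autFactor_mul_smul ModularGroup.S τ
  rw [autFactor_S] at h
  rw [eq_div_iff (UpperHalfPlane.ne_zero τ), mul_comm, h]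
  simp [ModularGroup.coe_S]

theorem thetaTerm_T (r : B.dual) (τ : ℍ) (z : ℂ ⊗[ℤ] L) :
    B.thetaTerm r (ModularGroup.T • τ) z =
      ratChar (B.discQuad (B.cls r)) * B.thetaTerm r τ z := by
  rw [thetaTerm, thetaTerm, discQuad_cls, ratChar_coe, ← e_add, coe_T_smul]
  congr 1
  ring

theorem theta_T_smul (y : B.Disc) (τ : ℍ) (z : ℂ ⊗[ℤ] L) :
    B.theta y (ModularGroup.T • τ) z = ratChar (B.discQuad y) * B.theta y τ z := by
  rw [theta, theta, ← tsum_mul_left]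
  refine tsum_congr fun r => ?_
  rw [thetaTerm_T, r.2]

theorem slashSL_zero_T (φ : ℍ → ℂ ⊗[ℤ] L → ℂ) (τ : ℍ) (z : ℂ ⊗[ℤ] L) :
    B.slashSL 0 ModularGroup.T φ τ z = φ (ModularGroup.T • τ) z := by
  have h10 : ModularGroup.T 1 0 = 0 := by simp [ModularGroup.coe_T]
  have h11 : ModularGroup.T 1 1 = 1 := by simp [ModularGroup.coe_T]
  simp [slashSL, autFactor, h10, h11, e_zero]

/-- Enumeration by `L` of the elements of `L^#` in the class of `r₀`. -/
def classEquiv (r₀ : B.dual) : L ≃ {r : B.dual // B.cls r = B.cls r₀} :=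
  fiberEquiv (fun x : L => r₀ + ⟨inclQ L x, fun x' => ⟨_, B.bilQ_incl x x'⟩⟩)
    (fun x x' h => by
      have h1 := congrArg Subtype.val (add_left_cancel h)
      rw [← sub_eq_zero]
      exact B.eq_zero_of_inclQ (by rw [map_sub, sub_eq_zero]; exact h1))
    (fun r => by
      rw [cls_eq]
      refine exists_congr fun x => ⟨fun h => Subtype.ext ?_, fun h => ?_⟩
      · change (r₀ : ℚ ⊗[ℤ] L) + inclQ L x = r
        rw [h]; abel
      · rw [← h]
        change _ = ((r₀ : ℚ ⊗[ℤ] L) + inclQ L x) - r₀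
        abel)

theorem classEquiv_apply (r₀ : B.dual) (x : L) :
    ((B.classEquiv r₀ x : B.dual) : ℚ ⊗[ℤ] L) = r₀ + inclQ L x := rfl

theorem thetaTerm_neg (s r₀ : B.dual) (τ : ℍ) (z : ℂ ⊗[ℤ] L) :
    B.thetaTerm (-s) τ (ratToC L r₀ - z) =
      ratChar (-B.discBil (B.cls r₀) (B.cls s)) * B.thetaTerm s τ z := by
  have h : (-B.discBil (B.cls r₀) (B.cls s)) = ((-B.bilQ r₀ s : ℚ) : AddCircle (1 : ℚ)) := by
    rw [discBil_cls, AddCircle.coe_neg]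
  rw [h, ratChar_coe, Rat.cast_neg, ← bilC_ratToC, thetaTerm, thetaTerm, ← e_add, ← quadC_ratToC,
    ← quadC_ratToC, AddSubgroup.coe_neg, map_neg, quadC, quadC, map_sub, B.bilC_symm (ratToC L r₀)]
  simp only [map_neg, LinearMap.neg_apply]
  congr 1
  ring

/-- The scalar factor `(-iτ)^{n/2}` in the transformation of the theta series under `τ ↦ -1/τ`. -/
def inversionFactor (L : Type*) [AddCommGroup L] (τ : ℍ) : ℂ :=
  ((-Complex.I * τ) ^ (1 / 2 : ℂ)) ^ Module.finrank ℤ L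

theorem norm_inversionFactor (τ : ℍ) :
    ‖inversionFactor L τ‖ = ‖autFactor ModularGroup.S τ‖ ^ ((Module.finrank ℤ L : ℝ) / 2) := by
  have h : (1 / 2 : ℂ) = ((1 / 2 : ℝ) : ℂ) := by push_cast; rfl
  rw [inversionFactor, norm_pow, h, Complex.norm_cpow_real, autFactor_S, norm_mul, norm_neg,
    Complex.norm_I, one_mul, ← Real.rpow_mul_natCast (norm_nonneg _)]
  congr 1
  ring

theorem mdifferentiable_inversionFactor : MDiff (inversionFactor L) := by
  rw [UpperHalfPlane.mdifferentiable_iff]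
  have h : DifferentiableOn ℂ
      (fun w : ℂ => ((-Complex.I * w) ^ (1 / 2 : ℂ)) ^ Module.finrank ℤ L) {w | 0 < w.im} := by
    refine DifferentiableOn.pow (fun w hw => ?_) _
    refine DifferentiableAt.differentiableWithinAt ?_
    refine DifferentiableAt.cpow (by fun_prop) (by fun_prop) (Or.inl ?_)
    simpa using hw
  refine h.congr fun w hw => ?_
  rw [Function.comp_apply, inversionFactor, UpperHalfPlane.ofComplex_apply_of_im_pos hw]

/-! ### The Weil representation -/

variable [Module.Finite ℤ L]

open Classical in
/-- The matrix of the map `y ↦ ∑ (y + l x)`, for `y` orthogonal to `x` and `l` modulo the order of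
`x`, and `y ↦ 0` for the other `y`. -/
def isoMatrix (x : B.Disc) : Matrix B.Disc B.Disc ℂ := fun y y' =>
  if B.discBil x y = 0 then
    ∑ l ∈ Finset.range (addOrderOf x), if y' = y + l • x then 1 else 0
  else 0

open Classical in
theorem sum_isoMatrix_mul (x y : B.Disc) (f : B.Disc → ℂ) :
    ∑ y', B.isoMatrix x y y' * f y' =
      if B.discBil x y = 0 then ∑ l ∈ Finset.range (addOrderOf x), f (y + l • x) else 0 := by
  simp only [isoMatrix]
  split_ifs with h
  · simp only [Finset.sum_mul]
    rw [Finset.sum_comm]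
    simp
  · simp

open Classical in
theorem sum_mul_isoMatrix {x : B.Disc} (hx : B.discQuad x = 0) (y' : B.Disc) (f : B.Disc → ℂ) :
    ∑ y, f y * B.isoMatrix x y y' =
      if B.discBil x y' = 0 then ∑ l ∈ Finset.range (addOrderOf x), f (y' - l • x) else 0 := by
  have hb : ∀ l : ℕ, B.discBil x (y' - l • x) = B.discBil x y' := fun l => by
    rw [discBil_sub_right, discBil_nsmul_right, B.discBil_self_of_isotropic hx, smul_zero, sub_zero]
  have h1 : ∀ y, f y * B.isoMatrix x y y' = ∑ l ∈ Finset.range (addOrderOf x),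
      if y = y' - l • x then (if B.discBil x y' = 0 then f (y' - l • x) else 0) else 0 := by
    intro y
    rw [isoMatrix, mul_ite, mul_zero]
    split_ifs with h h' h'
    · rw [Finset.mul_sum]
      refine Finset.sum_congr rfl fun l _ => ?_
      rw [mul_ite, mul_one, mul_zero]
      by_cases hl : y = y' - l • x
      · rw [if_pos hl, if_pos (by rw [hl]; abel), hl]
      · rw [if_neg hl, if_neg fun h2 => hl (by rw [h2]; abel)]
    · rw [Finset.mul_sum]
      refine Finset.sum_congr rfl fun l _ => ?_
      rw [if_neg, mul_zero, ite_self]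
      intro h2
      rw [← hb l, h2, add_sub_cancel_right] at h'
      exact h' h
    · symm
      refine Finset.sum_eq_zero fun l _ => if_neg fun h2 => h ?_
      rw [h2, hb, h']
    · simp
  simp only [h1]
  rw [Finset.sum_comm]
  simp only [Finset.sum_ite_eq', Finset.mem_univ, if_true]
  split_ifs with h
  · rfl
  · simp

open Classical in
/-- The theta series transform under `A` by the scalar factor `j`, holomorphic of absolute value
`|cτ + d|^{n/2}`, and the unitary matrix `ρ`, which commutes with `isoMatrix x`. Up to a scalar of
absolute value `1`, the matrix `ρ` is the value at `A` of the Weil representation. -/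
structure IsWeil (x : B.Disc) (A : SL(2, ℤ)) (j : ℍ → ℂ) (ρ : Matrix B.Disc B.Disc ℂ) :
    Prop where
  mdiff : MDiff j
  norm_eq : ∀ τ, ‖j τ‖ = ‖autFactor A τ‖ ^ ((Module.finrank ℤ L : ℝ) / 2)
  unitary : ρ ∈ Matrix.unitaryGroup B.Disc ℂ
  comm : B.isoMatrix x * ρ = ρ * B.isoMatrix x
  slash_theta : ∀ y τ z, B.slashSL 0 A (B.theta y) τ z = j τ * ∑ y', ρ y y' * B.theta y' τ z

theorem isWeil_T {x : B.Disc} (hx : B.discQuad x = 0) : ∃ j ρ, B.IsWeil x ModularGroup.T j ρ := by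
  classical
  have h11 : ModularGroup.T 1 1 = 1 := by simp [ModularGroup.coe_T]
  have h10 : ModularGroup.T 1 0 = 0 := by simp [ModularGroup.coe_T]
  refine ⟨fun _ => 1, Matrix.diagonal fun y => ratChar (B.discQuad y), mdifferentiable_const,
    fun τ => ?_, ?_, ?_, fun y τ z => ?_⟩
  · simp [autFactor, h10, h11]
  · rw [Matrix.mem_unitaryGroup_iff, Matrix.star_eq_conjTranspose, Matrix.diagonal_conjTranspose,
      Matrix.diagonal_mul_diagonal, ← Matrix.diagonal_one]
    congr 1
    funext y
    rw [Pi.star_apply, star_ratChar, ← AddChar.map_add_eq_mul, add_neg_cancel,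
      AddChar.map_zero_eq_one]
  · ext y y'
    rw [Matrix.mul_diagonal, Matrix.diagonal_mul, isoMatrix, ite_mul, zero_mul, mul_ite, mul_zero]
    split_ifs with h
    · rw [Finset.sum_mul, Finset.mul_sum]
      refine Finset.sum_congr rfl fun l _ => ?_
      by_cases hl : y' = y + l • x
      · rw [hl, B.discQuad_add_nsmul hx h, mul_comm]
      · simp [hl]
    · rfl
  · rw [slashSL_zero_T, theta_T_smul, one_mul, Finset.sum_eq_single y]
    · rw [Matrix.diagonal_apply_eq]
    · intro y' _ hy
      rw [Matrix.diagonal_apply_ne _ hy.symm, zero_mul]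
    · simp

variable [Module.Free ℤ L]

/-- The inversion formula for the theta series, with an unspecified positive constant. -/
theorem exists_theta_inversion : ∃ κ : ℝ, 0 < κ ∧ ∀ (y : B.Disc) (τ : ℍ) (z : ℂ ⊗[ℤ] L),
    B.slashSL 0 ModularGroup.S (B.theta y) τ z =
      inversionFactor L τ * ∑ y', (κ * ratChar (-B.discBil y y')) * B.theta y' τ z := by
  obtain ⟨F⟩ := B.exists_orthoFrame
  refine ⟨F.poissonConst, F.poissonConst_pos, fun y τ z => ?_⟩
  obtain ⟨r₀, rfl⟩ := QuotientAddGroup.mk_surjective y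
  have hτ := UpperHalfPlane.ne_zero τ
  have h10 : ModularGroup.S 1 0 = 1 := by simp [ModularGroup.coe_S]
  have hterm : ∀ r : B.dual, B.thetaTerm r (ModularGroup.S • τ) ((τ : ℂ)⁻¹ • z) *
      e (-1 * B.quadC z / τ) = e (-B.quadC (ratToC L r - z) / τ) := by
    intro r
    rw [thetaTerm, ← e_add, ← quadC_ratToC, coe_S_smul, map_smul, smul_eq_mul, sub_eq_add_neg,
      quadC_add]
    have h1 : B.quadC (-z) = B.quadC z := by simp [quadC]
    rw [h1, map_neg]
    congr 1
    field_simp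
    ring
  have hneg : ∑' s : B.dual, B.thetaTerm s τ (ratToC L r₀ - z) =
      ∑ y', ratChar (-B.discBil (B.cls r₀) y') * B.theta y' τ z := by
    rw [← (Equiv.neg B.dual).tsum_eq]
    simp only [Equiv.neg_apply, thetaTerm_neg]
    exact (B.hasSum_cls_mul_thetaTerm (fun y' => ratChar (-B.discBil (B.cls r₀) y')) τ z).tsum_eq
  have h1 := F.hasSum_gaussian_lattice τ (ratToC L r₀ - z)
  rw [slashSL, autFactor_S, h10, theta, Int.cast_one, neg_zero, zpow_zero, mul_one,
    ← tsum_mul_right]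
  simp only [hterm]
  rw [← (B.classEquiv r₀).tsum_eq]
  simp only [classEquiv_apply, map_add, ratToC_incl]
  have h2 : ∀ x : L, ratToC L (r₀ : ℚ ⊗[ℤ] L) + inclC L x - z =
      inclC L x + (ratToC L (r₀ : ℚ ⊗[ℤ] L) - z) := fun x => by abel
  simp only [h2]
  rw [h1.tsum_eq, hneg, inversionFactor]
  simp only [mul_assoc, ← Finset.mul_sum]
  ring

theorem S_smul_I : ModularGroup.S • UpperHalfPlane.I = UpperHalfPlane.I := by
  ext1
  rw [coe_S_smul, UpperHalfPlane.coe_I]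
  simp

theorem isWeil_S {x : B.Disc} (hx : B.discQuad x = 0) : ∃ j ρ, B.IsWeil x ModularGroup.S j ρ := by
  classical
  obtain ⟨κ, hκ, hS⟩ := B.exists_theta_inversion
  have hbil : ∀ a b c, B.discBil (a - b) c = B.discBil a c - B.discBil b c := fun a b c => by
    rw [B.discBil_symm, discBil_sub_right, B.discBil_symm c, B.discBil_symm c]
  -- the square of the inversion fixes `ϑ₀`, which determines the constant
  have hκ2 : (κ : ℂ) * κ * Fintype.card B.Disc = 1 := by
    have hI : inversionFactor L UpperHalfPlane.I = 1 := by
      rw [inversionFactor, UpperHalfPlane.coe_I]; simp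
    have hneg : ∀ z, B.theta 0 UpperHalfPlane.I z =
        (κ : ℂ) * κ * Fintype.card B.Disc * B.theta 0 UpperHalfPlane.I (-z) := by
      intro z
      have h1 : ∀ τ z, B.slashSL 0 ModularGroup.S (B.theta 0) τ z =
        inversionFactor L τ * ∑ y', (κ : ℂ) * B.theta y' τ z := by
        intro τ z
        rw [hS]
        simp only [B.discBil_symm 0, discBil_zero_right, neg_zero, AddChar.map_zero_eq_one, mul_one]
      have h2 : B.slashSL 0 (ModularGroup.S * ModularGroup.S) (B.theta 0) UpperHalfPlane.I (-z) =
          (κ : ℂ) * κ * Fintype.card B.Disc * B.theta 0 UpperHalfPlane.I (-z) := by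
        rw [slashSL_mul, show B.slashSL 0 ModularGroup.S (B.theta 0) = fun τ z => _ from
          funext fun τ => funext fun z => h1 τ z, slashSL_mul_sum, S_smul_I, hI, one_mul]
        simp only [hS, hI, one_mul]
        rw [← Finset.mul_sum, Finset.sum_comm]
        have h3 : ∀ y', ∑ y, κ * ratChar (-B.discBil y y') * B.theta y' UpperHalfPlane.I (-z) =
            if y' = 0 then κ * Fintype.card B.Disc * B.theta y' UpperHalfPlane.I (-z) else 0 := by
          intro y'
          have h4 : ∀ y, ratChar (-B.discBil y y') = ratChar (B.discBil (-y') y) := fun y => by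
            rw [B.discBil_symm (-y'), discBil_neg_right]
          simp only [h4]
          rw [← Finset.sum_mul, ← Finset.mul_sum, sum_ratChar_discBil]
          simp only [neg_eq_zero]
          split_ifs <;> simp
        simp only [h3]
        rw [Finset.sum_ite_eq', if_pos (Finset.mem_univ _)]
        ring
      have hSS : ModularGroup.S * ModularGroup.S = -1 := by
        ext i j; fin_cases i <;> fin_cases j <;> rfl
      rw [← h2, hSS, slashSL]
      have h10 : (-1 : SL(2, ℤ)) 1 0 = 0 := by simp
      have h11 : autFactor (-1) UpperHalfPlane.I = -1 := by simp [autFactor]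
      rw [h10, h11, ModularGroup.SL_neg_smul, one_smul]
      simp [e_zero]
    have h0 := B.theta_linearIndependent UpperHalfPlane.I
      (fun y => if y = 0 then 1 - ((κ : ℂ) * κ * Fintype.card B.Disc) ^ 2 else 0) (fun z => by
        simp only [ite_mul, zero_mul, Finset.sum_ite_eq', Finset.mem_univ, if_true]
        have h1 := hneg z
        have h2 := hneg (-z)
        rw [neg_neg] at h2
        linear_combination h1 + (κ : ℂ) * κ * Fintype.card B.Disc * h2) 0
    rw [if_pos rfl, sub_eq_zero] at h0
    have h1 : (κ * κ * Fintype.card B.Disc : ℝ) ^ 2 = 1 := by exact_mod_cast h0.symm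
    rw [pow_eq_one_iff_of_nonneg (by positivity) two_ne_zero] at h1
    exact_mod_cast h1
  refine ⟨inversionFactor L, Matrix.of fun y y' => κ * ratChar (-B.discBil y y'),
    mdifferentiable_inversionFactor, norm_inversionFactor, ?_, ?_, hS⟩
  · rw [Matrix.mem_unitaryGroup_iff]
    ext y y'
    rw [Matrix.mul_apply, Matrix.one_apply]
    have h1 : ∀ b, (κ * ratChar (-B.discBil y b)) *
        (star (Matrix.of fun y y' => κ * ratChar (-B.discBil y y'))) b y' =
        κ * κ * ratChar (B.discBil (y' - y) b) := by
      intro b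
      rw [Matrix.star_apply, Matrix.of_apply, star_mul', star_ratChar, neg_neg, hbil, sub_eq_add_neg,
        AddChar.map_add_eq_mul, show star (κ : ℂ) = κ from Complex.conj_ofReal κ]
      ring
    simp only [Matrix.of_apply, h1]
    rw [← Finset.mul_sum, sum_ratChar_discBil]
    by_cases h : y = y'
    · rw [if_pos (sub_eq_zero.2 h.symm), if_pos h, hκ2]
    · rw [if_neg (fun h2 => h (sub_eq_zero.1 h2).symm), if_neg h, mul_zero]
  · have hN : ∀ y, addOrderOf x • B.discBil y x = 0 := fun y => by
      rw [← discBil_nsmul_right, addOrderOf_nsmul_eq_zero, discBil_zero_right]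
    ext y y'
    rw [Matrix.mul_apply, Matrix.mul_apply]
    simp only [Matrix.of_apply]
    rw [B.sum_isoMatrix_mul x y,
      B.sum_mul_isoMatrix hx y' fun a => κ * ratChar (-B.discBil y a)]
    have h1 : ∀ l : ℕ, ratChar (-B.discBil (y + l • x) y') =
        ratChar (-B.discBil y y') * ratChar (l • -B.discBil y' x) := by
      intro l
      rw [← AddChar.map_add_eq_mul, B.discBil_symm _ y', discBil_add_right, discBil_nsmul_right,
        B.discBil_symm y' y, smul_neg, neg_add]
    have h2 : ∀ l : ℕ, ratChar (-B.discBil y (y' - l • x)) =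
        ratChar (-B.discBil y y') * ratChar (l • B.discBil y x) := by
      intro l
      rw [← AddChar.map_add_eq_mul, discBil_sub_right, discBil_nsmul_right]
      congr 1
      abel
    simp only [h1, h2, ← Finset.mul_sum]
    rw [sum_ratChar_nsmul (hN y), sum_ratChar_nsmul (by rw [smul_neg, hN, neg_zero])]
    simp only [neg_eq_zero, B.discBil_symm _ x]
    split_ifs <;> simp

end PosDefEvenForm

theorem mdifferentiable_comp_smul {f : ℍ → ℂ} (hf : MDiff f) (A : SL(2, ℤ)) :
    MDiff fun τ : ℍ => f (A • τ) := by
  refine hf.comp (UpperHalfPlane.mdifferentiable_smul (g := (A : GL (Fin 2) ℝ)) ?_)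
  simp

theorem mdifferentiable_mul {f g : ℍ → ℂ} (hf : MDiff f) (hg : MDiff g) :
    MDiff fun τ => f τ * g τ := by
  rw [UpperHalfPlane.mdifferentiable_iff] at *
  exact hf.mul hg

theorem mdifferentiable_inv {f : ℍ → ℂ} (hf : MDiff f) (h0 : ∀ τ, f τ ≠ 0) :
    MDiff fun τ => (f τ)⁻¹ := by
  rw [UpperHalfPlane.mdifferentiable_iff] at *
  exact hf.inv fun w _ => h0 _

theorem autFactor_one (τ : ℍ) : autFactor 1 τ = 1 := by simp [autFactor]

namespace PosDefEvenForm

variable (B : PosDefEvenForm L) [Module.Finite ℤ L]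

variable {B} in
theorem IsWeil.mul {x : B.Disc} {A A' : SL(2, ℤ)} {j j' : ℍ → ℂ} {ρ ρ' : Matrix B.Disc B.Disc ℂ}
    (h : B.IsWeil x A j ρ) (h' : B.IsWeil x A' j' ρ') :
    B.IsWeil x (A * A') (fun τ => j (A' • τ) * j' τ) (ρ * ρ') := by
  classical
  refine ⟨mdifferentiable_mul (mdifferentiable_comp_smul h.mdiff A') h'.mdiff, fun τ => ?_,
    mul_mem h.unitary h'.unitary, ?_, fun y τ z => ?_⟩
  · rw [norm_mul, h.norm_eq, h'.norm_eq, autFactor_mul, norm_mul,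
      Real.mul_rpow (norm_nonneg _) (norm_nonneg _)]
  · rw [← mul_assoc, h.comm, mul_assoc, h'.comm, mul_assoc]
  · rw [slashSL_mul, show B.slashSL 0 A (B.theta y) = fun τ z => _ from
      funext fun τ => funext fun z => h.slash_theta y τ z, slashSL_mul_sum]
    simp only [h'.slash_theta, Matrix.mul_apply, Finset.sum_mul, Finset.mul_sum]
    rw [Finset.sum_comm]
    refine Finset.sum_congr rfl fun _ _ => Finset.sum_congr rfl fun _ _ => by ring

variable {B} in
theorem IsWeil.inv {x : B.Disc} {A : SL(2, ℤ)} {j : ℍ → ℂ} {ρ : Matrix B.Disc B.Disc ℂ}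
    (h : B.IsWeil x A j ρ) : B.IsWeil x A⁻¹ (fun τ => (j (A⁻¹ • τ))⁻¹) (star ρ) := by
  classical
  have haut : ∀ τ, autFactor A⁻¹ τ = (autFactor A (A⁻¹ • τ))⁻¹ := by
    intro τ
    have h1 := autFactor_mul A A⁻¹ τ
    rw [mul_inv_cancel, autFactor_one] at h1
    exact eq_inv_of_mul_eq_one_right h1.symm
  have hj0 : ∀ τ, j τ ≠ 0 := by
    intro τ h0
    have h1 := h.norm_eq τ
    rw [h0, norm_zero] at h1
    exact (Real.rpow_pos_of_pos (norm_pos_iff.2 (autFactor_ne_zero A τ)) _).ne h1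
  have hu : star ρ * ρ = 1 := Matrix.mem_unitaryGroup_iff'.1 h.unitary
  have hu' : ρ * star ρ = 1 := Matrix.mem_unitaryGroup_iff.1 h.unitary
  refine ⟨mdifferentiable_inv (mdifferentiable_comp_smul h.mdiff A⁻¹) fun τ => hj0 _, fun τ => ?_,
    Unitary.star_mem h.unitary, ?_, fun y τ z => ?_⟩
  · rw [norm_inv, h.norm_eq, haut, norm_inv, Real.inv_rpow (norm_nonneg _)]
  · calc B.isoMatrix x * star ρ = star ρ * ρ * B.isoMatrix x * star ρ := by rw [hu, one_mul]
      _ = star ρ * (ρ * B.isoMatrix x) * star ρ := by simp only [mul_assoc]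
      _ = star ρ * B.isoMatrix x * (ρ * star ρ) := by rw [← h.comm]; simp only [mul_assoc]
      _ = star ρ * B.isoMatrix x := by rw [hu', mul_one]
  · have h1 : ∀ y', B.theta y' τ z =
        j (A⁻¹ • τ) * ∑ y'', ρ y' y'' * B.slashSL 0 A⁻¹ (B.theta y'') τ z := by
      intro y'
      rw [← slashSL_mul_sum, ← show B.slashSL 0 A (B.theta y') = fun τ z => _ from
        funext fun τ => funext fun z => h.slash_theta y' τ z, ← slashSL_mul, mul_inv_cancel,
        slashSL_one]
    have h2 : ∑ y', (star ρ) y y' * B.theta y' τ z =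
        j (A⁻¹ • τ) * B.slashSL 0 A⁻¹ (B.theta y) τ z := by
      calc ∑ y', (star ρ) y y' * B.theta y' τ z
          = ∑ y', ∑ y'', j (A⁻¹ • τ) * ((star ρ) y y' * ρ y' y'' *
              B.slashSL 0 A⁻¹ (B.theta y'') τ z) := by
            refine Finset.sum_congr rfl fun y' _ => ?_
            rw [h1 y', Finset.mul_sum, Finset.mul_sum]
            exact Finset.sum_congr rfl fun _ _ => by ring
        _ = j (A⁻¹ • τ) * ∑ y'', (star ρ * ρ) y y'' * B.slashSL 0 A⁻¹ (B.theta y'') τ z := by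
            rw [Finset.sum_comm, Finset.mul_sum]
            refine Finset.sum_congr rfl fun y'' _ => ?_
            rw [Matrix.mul_apply, Finset.sum_mul, Finset.mul_sum]
        _ = _ := by
            rw [hu]
            simp [Matrix.one_apply]
    rw [h2, inv_mul_cancel_left₀ (hj0 _)]

/-- Every `A` in `SL₂(ℤ)` acts through some unitary matrix, by induction on a word in the generators
`S` and `T`. -/
theorem exists_isWeil [Module.Free ℤ L] {x : B.Disc} (hx : B.discQuad x = 0) (A : SL(2, ℤ)) :
    ∃ j ρ, B.IsWeil x A j ρ := by
  classical
  have hA : A ∈ Subgroup.closure {ModularGroup.S, ModularGroup.T} := by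
    rw [SpecialLinearGroup.SL2Z_generators]; trivial
  induction hA using Subgroup.closure_induction with
  | mem A hA =>
    rcases hA with rfl | rfl
    · exact B.isWeil_S hx
    · exact B.isWeil_T hx
  | one =>
    refine ⟨fun _ => 1, 1, mdifferentiable_const, fun τ => ?_, one_mem _, by simp, fun y τ z => ?_⟩
    · simp [autFactor_one]
    · simp [slashSL_one, Matrix.one_apply]
  | mul A A' _ _ h h' =>
    obtain ⟨j, ρ, h⟩ := h
    obtain ⟨j', ρ', h'⟩ := h'
    exact ⟨_, _, h.mul h'⟩
  | inv A _ h =>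
    obtain ⟨j, ρ, h⟩ := h
    exact ⟨_, _, h.inv⟩

end PosDefEvenForm

/-! ### Summation over the cosets -/

/-- Enumeration by `L` of the cosets in `J_∞ \ J` over the coset of `A`. -/
def cosetEquiv (L : Type*) [AddCommGroup L] (A : SL(2, ℤ)) :
    L ≃ {q : JacobiCosets L // proj q = Quotient.mk _ A} :=
  fiberEquiv (fun l : L => Quotient.mk _ (⟨1, l, 0⟩ * ⟨A, 0, 0⟩ : JacobiGroup L))
    (fun l l' h => by
      have h1 := (QuotientGroup.rightRel_apply.1 (Quotient.exact h)).2
      rw [mul_inv_rev, mul_assoc, mul_inv_cancel_left, PosDefEvenForm.inv_translate] at h1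
      simp only [JacobiGroup.mul_x] at h1
      simpa [add_neg_eq_zero, eq_comm] using h1)
    (fun q => by
      induction q using Quotient.inductionOn with
      | h γ =>
        constructor
        · intro h
          have h1 : A * γ.A⁻¹ ∈ gammaInf := QuotientGroup.rightRel_apply.1 (Quotient.exact h)
          obtain ⟨A', x, y⟩ := γ
          -- the coset contains `(A, h)` for some `h`, and `(A, h) = (1, h')(A, 0)`
          refine ⟨A⁻¹ 0 0 • x + A⁻¹ 1 0 • y, Quotient.sound (QuotientGroup.rightRel_apply.2 ?_)⟩
          rw [mul_inv_rev, PosDefEvenForm.inv_translate, ← mul_assoc]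
          refine ⟨?_, ?_⟩
          · simpa using inv_mem h1
          · simp only [JacobiGroup.mul_x, JacobiGroup.inv_A, JacobiGroup.inv_x, JacobiGroup.mul_y,
              JacobiGroup.inv_y]
            simp
        · rintro ⟨l, hl⟩
          rw [← hl]
          change (Quotient.mk _ (1 * A) : GammaCosets) = _
          rw [one_mul])

theorem cosetEquiv_apply (A : SL(2, ℤ)) (l : L) :
    (cosetEquiv L A l : JacobiCosets L) = Quotient.mk _ (⟨1, l, 0⟩ * ⟨A, 0, 0⟩) := rfl

/-- The second row of a matrix in the given coset in `Γ_∞ \ SL₂(ℤ)`. -/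
def cosetRow (a : GammaCosets) : Fin 2 → ℤ := fun i => a.out 1 i

theorem mem_gammaInf_of_row {A : SL(2, ℤ)} (h10 : A 1 0 = 0) (h11 : A 1 1 = 1) : A ∈ gammaInf := by
  have hdet : A 0 0 * A 1 1 - A 0 1 * A 1 0 = 1 := by
    rw [← Matrix.det_fin_two]; exact A.det_coe
  rw [h10, h11, mul_one, mul_zero, sub_zero] at hdet
  refine Subgroup.mem_zpowers_iff.2 ⟨A 0 1, ?_⟩
  ext i j
  rw [ModularGroup.coe_T_zpow]
  fin_cases i <;> fin_cases j <;> simp [h10, h11, hdet]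

/-- Two matrices with the same bottom row differ by a power of `T` on the left. -/
theorem cosetRow_injective : Function.Injective cosetRow := by
  intro a b h
  have h0 : a.out 1 0 = b.out 1 0 := congrFun h 0
  have h1 : a.out 1 1 = b.out 1 1 := congrFun h 1
  have hdet : a.out 0 0 * a.out 1 1 - a.out 0 1 * a.out 1 0 = 1 := by
    rw [← Matrix.det_fin_two]; exact a.out.det_coe
  rw [← Quotient.out_eq a, ← Quotient.out_eq b]
  refine Quotient.sound (QuotientGroup.rightRel_apply.2 (mem_gammaInf_of_row ?_ ?_))
  · simp [Matrix.mul_apply, Fin.sum_univ_two, Matrix.adjugate_fin_two, ← h0, ← h1]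
    ring
  · simp [Matrix.mul_apply, Fin.sum_univ_two, Matrix.adjugate_fin_two, ← h0, ← h1]
    linarith

theorem summable_norm_cosetRow {s : ℝ} (hs : 2 < s) :
    Summable fun a : GammaCosets => ‖cosetRow a‖ ^ (-s) :=
  (EisensteinSeries.summable_one_div_norm_rpow hs).comp_injective cosetRow_injective

/-- Uniformly on a vertical strip, `|cτ + d|` is comparable to the size of the pair `(c, d)`. -/
theorem exists_autFactor_bound {s : ℝ} (hs : 0 ≤ s) (M : ℝ) {H : ℝ} (hH : 0 < H) :
    ∃ C : ℝ, ∀ τ : ℍ, |τ.re| ≤ M → H ≤ τ.im → ∀ a : GammaCosets,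
      ‖autFactor a.out τ‖ ^ (-s) ≤ C * ‖cosetRow a‖ ^ (-s) :=
  ⟨_, fun _ h1 h2 a =>
    EisensteinSeries.summand_bound_of_mem_verticalStrip hs (cosetRow a) hH ⟨h1, h2⟩⟩

theorem summable_autFactor {s : ℝ} (hs : 2 < s) (τ : ℍ) :
    Summable fun a : GammaCosets => ‖autFactor a.out τ‖ ^ (-s) := by
  obtain ⟨C, hC⟩ := exists_autFactor_bound (by linarith : 0 ≤ s) |τ.re| τ.im_pos
  exact Summable.of_nonneg_of_le (fun _ => Real.rpow_nonneg (norm_nonneg _) _)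
    (fun a => hC τ le_rfl le_rfl a) ((summable_norm_cosetRow hs).mul_left C)

theorem mdifferentiable_autFactor_zpow (A : SL(2, ℤ)) (k : ℤ) :
    MDiff fun τ : ℍ => autFactor A τ ^ k := by
  rw [UpperHalfPlane.mdifferentiable_iff]
  have h : DifferentiableOn ℂ (fun w : ℂ => (A 1 0 * w + A 1 1) ^ k) {w | 0 < w.im} := by
    intro w hw
    refine DifferentiableAt.differentiableWithinAt (DifferentiableAt.zpow (by fun_prop) (Or.inl ?_))
    exact PosDefEvenForm.autFactor_ne_zero A ⟨w, hw⟩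
  refine h.congr fun w hw => ?_
  rw [Function.comp_apply, autFactor, UpperHalfPlane.ofComplex_apply_of_im_pos hw]

/-- A series of holomorphic functions on the upper half plane is holomorphic, and bounded in
vertical strips, if its terms are dominated by `|cτ + d|^{-s}` with `s > 2`. -/
theorem mdifferentiable_tsum_and_bounded {s : ℝ} (hs : 2 < s) {f : GammaCosets → ℍ → ℂ}
    (hf : ∀ a, MDiff (f a)) (hle : ∀ a τ, ‖f a τ‖ ≤ ‖autFactor a.out τ‖ ^ (-s)) :
    MDiff (fun τ => ∑' a, f a τ) ∧ ∀ M H : ℝ, 0 < H →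
      ∃ C, ∀ τ : ℍ, |τ.re| ≤ M → H ≤ τ.im → ‖∑' a, f a τ‖ ≤ C := by
  constructor
  · rw [UpperHalfPlane.mdifferentiable_iff]
    intro w hw
    obtain ⟨C, hC⟩ := exists_autFactor_bound (by linarith : 0 ≤ s) (|w.re| + 1)
      (half_pos (show 0 < w.im from hw))
    have hU : IsOpen {w' : ℂ | |w'.re| < |w.re| + 1 ∧ w.im / 2 < w'.im} :=
      (isOpen_lt (Complex.continuous_re.abs) continuous_const).inter
        (isOpen_lt continuous_const Complex.continuous_im)
    have hpos : ∀ w' ∈ {w' : ℂ | |w'.re| < |w.re| + 1 ∧ w.im / 2 < w'.im}, 0 < w'.im :=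
      fun w' h => (half_pos (show 0 < w.im from hw)).trans h.2
    have h1 := Complex.differentiableOn_tsum_of_summable_norm
      (F := fun a => f a ∘ UpperHalfPlane.ofComplex)
      ((summable_norm_cosetRow hs).mul_left C)
      (fun a => (UpperHalfPlane.mdifferentiable_iff.1 (hf a)).mono hpos) hU (fun a w' hw' => by
        refine (hle a _).trans (hC _ ?_ ?_ a)
        · rw [UpperHalfPlane.ofComplex_apply_of_im_pos (hpos w' hw')]; exact hw'.1.le
        · rw [UpperHalfPlane.ofComplex_apply_of_im_pos (hpos w' hw')]; exact hw'.2.le)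
    refine (h1.differentiableAt (hU.mem_nhds ⟨by linarith, ?_⟩)).differentiableWithinAt
    exact half_lt_self hw
  · intro M H hH
    obtain ⟨C, hC⟩ := exists_autFactor_bound (by linarith : 0 ≤ s) M hH
    refine ⟨∑' a, C * ‖cosetRow a‖ ^ (-s), fun τ h1 h2 => ?_⟩
    exact tsum_of_norm_bounded ((summable_norm_cosetRow hs).mul_left C).hasSum
      fun a => (hle a τ).trans (hC τ h1 h2 a)

namespace PosDefEvenForm

variable (B : PosDefEvenForm L)

theorem gFun_zero (r : B.dual) : B.gFun 0 r = B.thetaTerm r := by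
  funext τ z
  simp [gFun, thetaTerm]

theorem isotropic_iff (r : B.dual) : B.discQuad (B.cls r) = 0 ↔ ∃ n : ℤ, B.quadQ r - 0 = n := by
  rw [discQuad_cls, coe_eq_zero_iff_int, sub_zero]

variable [Module.Free ℤ L] [Module.Finite ℤ L]

/-- The part over the coset of `A` of the series `E_r` is the transform of a theta series. -/
theorem hasSum_cosetTerm (k : ℤ) {r : B.dual} (hr : B.discQuad (B.cls r) = 0) (A : SL(2, ℤ))
    (τ : ℍ) (z : ℂ ⊗[ℤ] L) :
    HasSum (fun q : {q : JacobiCosets L // proj q = Quotient.mk _ A} => B.cosetTerm k 0 r q τ z)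
      (B.slashSL k A (B.theta (B.cls r)) τ z) := by
  rw [← (cosetEquiv L A).hasSum_iff]
  have h1 : ∀ l : L, B.cosetTerm k 0 r (cosetEquiv L A l) τ z =
      B.slashSL k A (B.thetaTerm (B.classEquiv r l)) τ z := by
    intro l
    rw [cosetEquiv_apply, B.cosetTerm_mk k 0 r ((B.isotropic_iff r).1 hr), slash_mul,
      ← B.gFun_translate k _ r l (B.classEquiv_apply r l), slash_matrix, gFun_zero]
  simp only [Function.comp_def, h1]
  exact (((B.classEquiv r).hasSum_iff.2 (B.hasSum_theta _ _ _)).mul_right _).mul_right _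

theorem fiberSum_mk (k : ℤ) {r : B.dual} (hr : B.discQuad (B.cls r) = 0) (A : SL(2, ℤ))
    (τ : ℍ) (z : ℂ ⊗[ℤ] L) :
    B.fiberSum k 0 r (Quotient.mk _ A) τ z = B.slashSL k A (B.theta (B.cls r)) τ z :=
  (B.hasSum_cosetTerm k hr A τ z).tsum_eq

/-- The theta decomposition of the part of the series `E_r` over a coset in `Γ_∞ \ SL₂(ℤ)`. -/
theorem exists_coset_coeff (k : ℤ) {x : B.Disc} (hx : B.discQuad x = 0) :
    ∃ c : GammaCosets → B.Disc → B.Disc → ℍ → ℂ,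
      (∀ a y y', MDiff (c a y y')) ∧
      (∀ a y y' τ, ‖c a y y' τ‖ ≤
        ‖autFactor a.out τ‖ ^ (-((k : ℝ) - (Module.finrank ℤ L : ℝ) / 2))) ∧
      (∀ a (r : B.dual), B.discQuad (B.cls r) = 0 → ∀ τ z,
        B.fiberSum k 0 r a τ z = ∑ y', c a (B.cls r) y' τ * B.theta y' τ z) ∧
      (∀ a y y' τ, ∑ y'', B.isoMatrix x y y'' * c a y'' y' τ =
        ∑ y'', c a y y'' τ * B.isoMatrix x y'' y') := by
  classical
  choose j ρ hW using fun a : GammaCosets => B.exists_isWeil hx a.out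
  refine ⟨fun a y y' τ => autFactor a.out τ ^ (-k) * (j a τ * ρ a y y'), fun a y y' => ?_,
    fun a y y' τ => ?_, fun a r hr τ z => ?_, fun a y y' τ => ?_⟩
  · exact mdifferentiable_mul (mdifferentiable_autFactor_zpow _ _)
      (mdifferentiable_mul (hW a).mdiff mdifferentiable_const)
  · have h0 : 0 < ‖autFactor a.out τ‖ := norm_pos_iff.2 (autFactor_ne_zero _ τ)
    rw [norm_mul, norm_mul, norm_zpow, (hW a).norm_eq, neg_sub, Real.rpow_sub h0, Real.rpow_intCast,
      zpow_neg, inv_mul_eq_div]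
    refine div_le_div_of_nonneg_right ?_ (zpow_nonneg h0.le _)
    exact mul_le_of_le_one_right (Real.rpow_nonneg h0.le _)
      (entry_norm_bound_of_unitary (hW a).unitary y y')
  · conv_lhs => rw [← Quotient.out_eq a]
    rw [B.fiberSum_mk k hr, slashSL_eq_mul, (hW a).slash_theta, Finset.mul_sum, Finset.mul_sum]
    exact Finset.sum_congr rfl fun _ _ => by ring
  · have h1 := congrFun (congrFun (hW a).comm y) y'
    rw [Matrix.mul_apply, Matrix.mul_apply] at h1
    calc _ = autFactor a.out τ ^ (-k) * j a τ * ∑ y'', B.isoMatrix x y y'' * ρ a y'' y' := by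
          rw [Finset.mul_sum]
          exact Finset.sum_congr rfl fun _ _ => by ring
      _ = _ := by
          rw [h1, Finset.mul_sum]
          exact Finset.sum_congr rfl fun _ _ => by ring

end PosDefEvenForm

/-! ### Fourier expansions -/

theorem norm_e (w : ℂ) : ‖e w‖ = Real.exp (-2 * Real.pi * w.im) := by
  rw [e, Complex.norm_exp]
  simp

theorem mdifferentiable_e_mul (q : ℂ) : MDiff fun τ : ℍ => e (q * τ) := by
  rw [UpperHalfPlane.mdifferentiable_iff]
  have h : DifferentiableOn ℂ (fun w : ℂ => e (q * w)) {w | 0 < w.im} := by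
    unfold e
    fun_prop
  refine h.congr fun w hw => ?_
  rw [Function.comp_apply, UpperHalfPlane.ofComplex_apply_of_im_pos hw]

/-- A holomorphic function on the upper half plane that is bounded at the cusp and picks up the
factor `e(-q)` under `τ ↦ τ + 1`, for `q` in `[0, 1)`, is a series in the `e((m - q)τ)` with
`m - q ≥ 0`. -/
theorem exists_qExpansion {g : ℍ → ℂ} (hg : MDiff g)
    (hb : ∃ C, ∀ τ : ℍ, |τ.re| ≤ 1 → 1 ≤ τ.im → ‖g τ‖ ≤ C) {q : ℚ} (hq : 0 ≤ q)
    (hT : ∀ τ : ℍ, g (ModularGroup.T • τ) * e q = g τ) :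
    ∃ a : ℕ → ℂ, (0 < q → a 0 = 0) ∧ ∀ τ : ℍ, HasSum (fun m => a m * e ((m - q) * τ)) (g τ) := by
  obtain ⟨C, hC⟩ := hb
  set F : ℍ → ℂ := fun τ => g τ * e (q * τ) with hF
  have hFT : ∀ τ : ℍ, F (ModularGroup.T • τ) = F τ := by
    intro τ
    simp only [hF]
    rw [PosDefEvenForm.coe_T_smul, mul_add, mul_one, e_add, mul_comm (e _), ← mul_assoc, hT]
  have hper : Function.Periodic (F ∘ UpperHalfPlane.ofComplex) ((1 : ℝ) : ℂ) := by
    intro w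
    rw [Complex.ofReal_one]
    rcases lt_or_ge 0 w.im with hw | hw
    · have h1 : 0 < (w + 1).im := by simpa using hw
      rw [Function.comp_apply, Function.comp_apply, UpperHalfPlane.ofComplex_apply_of_im_pos h1,
        UpperHalfPlane.ofComplex_apply_of_im_pos hw, ← hFT ⟨w, hw⟩]
      congr 1
      ext1
      rw [PosDefEvenForm.coe_T_smul]
    · have h1 : (w + 1).im ≤ 0 := by simpa using hw
      rw [Function.comp_apply, Function.comp_apply, UpperHalfPlane.ofComplex_apply_of_im_nonpos h1,
        UpperHalfPlane.ofComplex_apply_of_im_nonpos hw]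
  have hbound : ∀ τ : ℍ, 1 ≤ τ.im → ‖F τ‖ ≤ C * Real.exp (-2 * Real.pi * q * τ.im) := by
    intro τ hτ
    obtain ⟨τ', h1, him, hre⟩ : ∃ τ' : ℍ, F τ' = F τ ∧ τ'.im = τ.im ∧ |τ'.re| ≤ 1 := by
      have h1 := hper.sub_zsmul_eq (x := (τ : ℂ)) ⌊τ.re⌋
      have him : 0 < ((τ : ℂ) - ⌊τ.re⌋ • ((1 : ℝ) : ℂ)).im := by simpa using τ.im_pos
      rw [Function.comp_apply, Function.comp_apply, UpperHalfPlane.ofComplex_apply,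
        UpperHalfPlane.ofComplex_apply_of_im_pos him] at h1
      refine ⟨_, h1, ?_, ?_⟩
      · change ((τ : ℂ) - ⌊τ.re⌋ • ((1 : ℝ) : ℂ)).im = _
        simp
      · have h2 : ((τ : ℂ) - ⌊τ.re⌋ • ((1 : ℝ) : ℂ)).re = Int.fract τ.re := by
          rw [Int.fract]; simp [-Int.self_sub_floor]
        change |((τ : ℂ) - ⌊τ.re⌋ • ((1 : ℝ) : ℂ)).re| ≤ 1
        rw [h2, abs_of_nonneg (Int.fract_nonneg _)]
        exact (Int.fract_lt_one _).le
    have h2 : ((q : ℂ) * (τ' : ℂ)).im = q * τ.im := by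
      rw [← Complex.ofReal_ratCast, Complex.im_ofReal_mul, ← him]; rfl
    rw [← h1, hF, norm_mul, norm_e, h2, ← mul_assoc]
    exact mul_le_mul_of_nonneg_right (hC τ' hre (by rw [him]; exact hτ)) (Real.exp_nonneg _)
  have hbound' : UpperHalfPlane.IsBoundedAtImInfty F := by
    rw [UpperHalfPlane.isBoundedAtImInfty_iff]
    refine ⟨|C|, 1, fun τ hτ => (hbound τ hτ).trans ?_⟩
    refine (mul_le_mul_of_nonneg_right (le_abs_self C) (Real.exp_nonneg _)).trans ?_
    refine mul_le_of_le_one_right (abs_nonneg _) (Real.exp_le_one_iff.2 ?_)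
    have h1 : (0 : ℝ) ≤ q := by exact_mod_cast hq
    have h2 := τ.im_pos
    have h3 : 0 ≤ 2 * Real.pi * q * τ.im := by positivity
    linarith
  have hhol : MDiff F := mdifferentiable_mul hg (mdifferentiable_e_mul q)
  refine ⟨fun m => (UpperHalfPlane.qExpansion 1 F).coeff m, fun hq0 => ?_, fun τ => ?_⟩
  · have hzero : UpperHalfPlane.IsZeroAtImInfty F := by
      refine squeeze_zero_norm' (a := fun τ : ℍ => C * Real.exp (-2 * Real.pi * q * τ.im)) ?_ ?_
      · exact (UpperHalfPlane.atImInfty_mem _).2 ⟨1, fun τ hτ => hbound τ hτ⟩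
      · have h1 : Filter.Tendsto (fun t : ℝ => C * Real.exp (-2 * Real.pi * q * t)) Filter.atTop
            (nhds (C * 0)) := by
          refine Filter.Tendsto.const_mul _ (Real.tendsto_exp_atBot.comp ?_)
          refine Filter.Tendsto.const_mul_atTop_of_neg ?_ Filter.tendsto_id
          have h1 : (0 : ℝ) < q := by exact_mod_cast hq0
          have h3 : 0 < 2 * Real.pi * q := by positivity
          linarith
        rw [mul_zero] at h1
        exact h1.comp Filter.tendsto_comap
    change (UpperHalfPlane.qExpansion 1 F).coeff 0 = 0
    rw [UpperHalfPlane.qExpansion_coeff_zero one_pos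
      (UpperHalfPlane.analyticAt_cuspFunction_zero one_pos hper hhol hbound') hper,
      hzero.valueAtInfty_eq_zero]
  · have h1 := (UpperHalfPlane.hasSum_qExpansion one_pos hper hhol hbound' τ).mul_right
      (e (-q * τ))
    have h2 : F τ * e (-q * τ) = g τ := by
      simp only [hF]
      rw [mul_assoc, ← e_add, neg_mul, add_neg_cancel, e_zero, mul_one]
    rw [h2] at h1
    refine h1.congr_fun fun m => ?_
    rw [smul_eq_mul, mul_assoc]
    congr 1
    rw [Function.Periodic.qParam, ← Complex.exp_nat_mul, sub_mul, sub_eq_add_neg, e_add, neg_mul]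
    congr 1
    rw [e]
    congr 1
    push_cast
    ring

namespace PosDefEvenForm

variable (B : PosDefEvenForm L)

theorem coe_eq_coe_iff (a b : ℚ) :
    (a : AddCircle (1 : ℚ)) = (b : AddCircle (1 : ℚ)) ↔ ∃ n : ℤ, b - a = n := by
  rw [eq_comm, ← sub_eq_zero, ← AddCircle.coe_sub, coe_eq_zero_iff_int]

/-- The functions `h_y` in a theta decomposition have expansions over the support, if they are
holomorphic and bounded at the cusp and satisfy `h_y(τ + 1) = e(-β(y)) h_y(τ)`. -/
theorem exists_suppAt_expansion (y : B.Disc) {g : ℍ → ℂ} (hg : MDiff g)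
    (hb : ∃ C, ∀ τ : ℍ, |τ.re| ≤ 1 → 1 ≤ τ.im → ‖g τ‖ ≤ C)
    (hT : ∀ τ : ℍ, g (ModularGroup.T • τ) * ratChar (B.discQuad y) = g τ) :
    ∃ C : ℚ → ℂ, ∀ τ : ℍ, HasSum (fun D : B.suppAt y => C D * e (-((D : ℚ) : ℂ) * τ)) (g τ) := by
  obtain ⟨p, hp⟩ := QuotientAddGroup.mk_surjective (B.discQuad y)
  set q : ℚ := Int.fract p with hq
  have hqy : (q : AddCircle (1 : ℚ)) = B.discQuad y := by
    rw [← hp]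
    exact (coe_eq_coe_iff _ _).2 ⟨⌊p⌋, by rw [hq, Int.fract]; ring⟩
  have hq0 : 0 ≤ q := Int.fract_nonneg p
  have hq1 : q < 1 := Int.fract_lt_one p
  rw [← hqy, ratChar_coe] at hT
  obtain ⟨a, ha, h⟩ := exists_qExpansion hg hb hq0 hT
  let φ : B.suppAt y → ℕ := fun D => ⌊q - D⌋.toNat
  have hφ : ∀ D : B.suppAt y, (D : ℚ) = q - φ D := by
    intro D
    have hD := D.2.2
    rw [← hqy, coe_eq_coe_iff] at hD
    obtain ⟨n, hn⟩ := hD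
    have hn0 : 0 ≤ n := by
      have h1 : (0 : ℚ) ≤ n := by rw [← hn]; linarith [D.2.1]
      exact_mod_cast h1
    have h1 : (φ D : ℤ) = n := by
      simp only [φ]
      rw [hn, Int.floor_intCast, Int.toNat_of_nonneg hn0]
    have h2 : ((φ D : ℕ) : ℚ) = n := by exact_mod_cast h1
    rw [h2, ← hn]; ring
  have hinj : Function.Injective φ := by
    intro D D' hDD
    refine Subtype.ext ?_
    rw [hφ D, hφ D', hDD]
  refine ⟨fun D => a ⌊q - D⌋.toNat, fun τ => ?_⟩
  have h1 := (hinj.hasSum_iff (fun m hm => ?_)).2 (h τ)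
  · refine h1.congr_fun fun D => ?_
    rw [Function.comp_apply]
    congr 2
    rw [hφ D]
    push_cast
    ring
  · -- an index outside the support has `m = 0` and `q > 0`
    have hm0 : m = 0 ∧ 0 < q := by
      by_contra hcon
      refine hm ⟨⟨q - m, ?_, ?_⟩, ?_⟩
      · rcases Nat.eq_zero_or_pos m with h0 | h0
        · have : q = 0 := le_antisymm (not_lt.1 fun h => hcon ⟨h0, h⟩) hq0
          rw [this, h0]; simp
        · have : (1 : ℚ) ≤ m := by exact_mod_cast h0
          linarith
      · rw [← hqy, coe_eq_coe_iff]
        exact ⟨m, by push_cast; ring⟩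
      · change ⌊q - (q - m)⌋.toNat = m
        rw [sub_sub_cancel, Int.floor_natCast, Int.toNat_natCast]
    rw [hm0.1, ha hm0.2, zero_mul]

theorem gFun_eq (D : ℚ) (r : B.dual) (τ : ℍ) (z : ℂ ⊗[ℤ] L) :
    B.gFun D r τ z = e (-(D : ℂ) * τ) * B.thetaTerm r τ z := by
  rw [gFun, thetaTerm, ← e_add]
  congr 1
  ring

theorem mem_suppAt_cls_iff (D : ℚ) (r : B.dual) :
    D ∈ B.suppAt (B.cls r) ↔ (D, r) ∈ B.supp := by
  refine and_congr_right fun _ => ?_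
  rw [discQuad_cls, coe_eq_coe_iff]

/-- The pairs `(D, r)` in the support with `r` in the class `y`. -/
def suppFiberEquiv (y : B.Disc) :
    B.suppAt y × {r : B.dual // B.cls r = y} ≃ {p : B.supp // B.cls (p : ℚ × B.dual).2 = y} where
  toFun p := ⟨⟨(p.1, p.2), (B.mem_suppAt_cls_iff _ _).1 (by rw [p.2.2]; exact p.1.2)⟩, p.2.2⟩
  invFun p := ⟨⟨p.1.1.1, by
    have := (B.mem_suppAt_cls_iff p.1.1.1 p.1.1.2).2 p.1.2
    rwa [p.2] at this⟩, ⟨p.1.1.2, p.2⟩⟩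
  left_inv _ := rfl
  right_inv _ := rfl

variable [Module.Free ℤ L] [Module.Finite ℤ L]

/-- A theta decomposition with expansions of the functions `h_y` is a Fourier expansion. -/
theorem hasFourierExpansion_of_theta {h : B.Disc → ℍ → ℂ} {C : ℚ → B.Disc → ℂ}
    (hC : ∀ y (τ : ℍ), HasSum (fun D : B.suppAt y => C D y * e (-((D : ℚ) : ℂ) * τ)) (h y τ)) :
    B.HasFourierExpansion (fun τ z => ∑ y, h y τ * B.theta y τ z) C := by
  intro τ z
  refine hasSum_of_fiberwise (fun p : B.supp => B.cls (p : ℚ × B.dual).2) _ _ fun y => ?_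
  rw [← (B.suppFiberEquiv y).hasSum_iff]
  have h1 := hC y τ
  have h2 := B.hasSum_theta y τ z
  generalize hf : (fun D : B.suppAt y => C D y * e (-((D : ℚ) : ℂ) * τ)) = f at h1
  generalize hg : (fun r : {r : B.dual // B.cls r = y} => B.thetaTerm r τ z) = g at h2
  have h3 := h1.mul h2 (summable_mul_of_summable_norm h1.summable.norm h2.summable.norm)
  refine h3.congr_fun fun p => ?_
  rw [← hf, ← hg, mul_assoc, ← gFun_eq]
  have h4 : B.cls (p.2 : B.dual) = y := p.2.2
  exact congrArg (fun y' => C p.1 y' * B.gFun p.1 p.2 τ z) h4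

/-- A Fourier expansion is a theta decomposition. -/
theorem theta_of_hasFourierExpansion {φ : ℍ → ℂ ⊗[ℤ] L → ℂ} {C : ℚ → B.Disc → ℂ}
    (hφ : B.HasFourierExpansion φ C) :
    (∀ y (τ : ℍ), Summable fun D : B.suppAt y => C D y * e (-((D : ℚ) : ℂ) * τ)) ∧
    ∀ τ z, φ τ z =
      ∑ y, (∑' D : B.suppAt y, C D y * e (-((D : ℚ) : ℂ) * τ)) * B.theta y τ z := by
  have hs : ∀ y (τ : ℍ), Summable fun D : B.suppAt y => C D y * e (-((D : ℚ) : ℂ) * τ) := by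
    intro y τ
    obtain ⟨r, rfl⟩ := QuotientAddGroup.mk_surjective y
    have h1 := (hφ τ 0).summable.comp_injective
      (i := fun D : B.suppAt (B.cls r) => (⟨(D, r), (B.mem_suppAt_cls_iff _ _).1 D.2⟩ : B.supp))
      fun D D' h => Subtype.ext (congrArg (fun p : B.supp => (p : ℚ × B.dual).1) h)
    simp only [Function.comp_def, gFun_eq, ← mul_assoc] at h1
    exact (summable_mul_right_iff (e_ne_zero _)).1 h1
  exact ⟨hs, fun τ z => (hφ τ z).unique
    (B.hasFourierExpansion_of_theta (fun y τ => (hs y τ).hasSum) τ z)⟩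

end PosDefEvenForm

/-! ### The theta decomposition of the Eisenstein series -/

/-- A sum over the multiples of `x` does not change under `x ↦ -x`. -/
theorem sum_range_sub_nsmul {M : Type*} [AddCommGroup M] (x y : M) (f : M → ℂ) :
    ∑ l ∈ Finset.range (addOrderOf x), f (y - l • x) =
      ∑ l ∈ Finset.range (addOrderOf x), f (y + l • x) := by
  have h1 : ∀ l ∈ Finset.range (addOrderOf x),
      f (y - (addOrderOf x - 1 - l) • x) = f (y + (l + 1) • x) := by
    intro l hl
    have hl' : l + 1 ≤ addOrderOf x := Finset.mem_range.1 hl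
    congr 1
    rw [sub_eq_iff_eq_add, add_assoc, ← add_nsmul,
      show l + 1 + (addOrderOf x - 1 - l) = addOrderOf x by omega, addOrderOf_nsmul_eq_zero,
      add_zero]
  rw [← Finset.sum_range_reflect, Finset.sum_congr rfl h1]
  have h2 := Finset.sum_range_succ (fun l => f (y + l • x)) (addOrderOf x)
  rw [Finset.sum_range_succ', addOrderOf_nsmul_eq_zero, zero_nsmul] at h2
  exact add_right_cancel h2

namespace PosDefEvenForm

variable (B : PosDefEvenForm L)

theorem discQuad_zero : B.discQuad 0 = 0 := by
  rw [show (0 : B.Disc) = B.cls 0 from rfl, discQuad_cls]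
  simp [quadQ]

theorem cls_out (y : B.Disc) : B.cls (Quotient.out y) = y := QuotientAddGroup.out_eq' y

theorem slashSL_T (k : ℤ) (φ : ℍ → ℂ ⊗[ℤ] L → ℂ) (τ : ℍ) (z : ℂ ⊗[ℤ] L) :
    B.slashSL k ModularGroup.T φ τ z = φ (ModularGroup.T • τ) z := by
  have h : autFactor ModularGroup.T τ = 1 := by simp [autFactor, ModularGroup.coe_T]
  rw [slashSL_eq_mul, slashSL_zero_T, h, one_zpow, one_mul]

variable [Module.Free ℤ L] [Module.Finite ℤ L]

theorem eisensteinConverges {k : ℤ} (hk : (Module.finrank ℤ L : ℚ) / 2 + 2 < k) {r : B.dual}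
    (hr : B.discQuad (B.cls r) = 0) : B.EisensteinConverges k r := by
  have hs : 2 < (k : ℝ) - (Module.finrank ℤ L : ℝ) / 2 := by
    have h := (Rat.cast_lt (K := ℝ)).2 hk
    push_cast at h
    linarith
  obtain ⟨c, -, hle, hsum, -⟩ := B.exists_coset_coeff k B.discQuad_zero
  intro τ z
  constructor
  · intro a
    rw [← Quotient.out_eq a]
    exact (B.hasSum_cosetTerm k hr a.out τ z).summable
  · simp only [hsum _ r hr]
    refine summable_sum fun y' _ => Summable.mul_right _ ?_
    exact Summable.of_norm_bounded (summable_autFactor hs τ) fun a => hle a _ y' τ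

/-- Right multiplication by `T` on `Γ_∞ \ SL₂(ℤ)`. -/
def cosetMulT : GammaCosets ≃ GammaCosets :=
  Quotient.congr (Equiv.mulRight ModularGroup.T) fun A A' => by
    rw [QuotientGroup.rightRel_apply, QuotientGroup.rightRel_apply]
    simp [mul_assoc]

theorem eisenstein_T_smul (k : ℤ) {r : B.dual} (hr : B.discQuad (B.cls r) = 0) (τ : ℍ)
    (z : ℂ ⊗[ℤ] L) :
    B.eisenstein k r (ModularGroup.T • τ) z = B.eisenstein k r τ z := by
  rw [eisenstein, eisenstein, poincare, poincare]
  conv_rhs => rw [← cosetMulT.tsum_eq]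
  congr 1
  refine tsum_congr fun a => ?_
  induction a using Quotient.inductionOn with
  | h A =>
    change _ = B.fiberSum k 0 r (Quotient.mk _ (A * ModularGroup.T)) τ z
    rw [B.fiberSum_mk k hr, B.fiberSum_mk k hr, slashSL_mul, slashSL_T]

/-- The theta decompositions of `E_0` and of `∑ E_{l x}`. They are related by the matrix
`isoMatrix x`, since it commutes with the Weil representation and maps `ϑ_0` to `∑ ϑ_{l x}`. -/
theorem exists_theta_decomposition {k : ℤ} (hk : (Module.finrank ℤ L : ℚ) / 2 + 2 < k)
    {x : B.Disc} (hx : B.discQuad x = 0) :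
    ∃ h : B.Disc → ℍ → ℂ, (∀ y, MDiff (h y)) ∧
      (∀ y, ∃ C, ∀ τ : ℍ, |τ.re| ≤ 1 → 1 ≤ τ.im → ‖h y τ‖ ≤ C) ∧
      (∀ τ z, B.eisensteinCls k 0 τ z = ∑ y, h y τ * B.theta y τ z) ∧
      ∀ τ z, ∑ l ∈ Finset.range (addOrderOf x), B.eisensteinCls k (l • x) τ z =
        ∑ y, (∑ y', h y' τ * B.isoMatrix x y' y) * B.theta y τ z := by
  have hs : 2 < (k : ℝ) - (Module.finrank ℤ L : ℝ) / 2 := by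
    have h := (Rat.cast_lt (K := ℝ)).2 hk
    push_cast at h
    linarith
  obtain ⟨c, hhol, hle, hsum, hcomm⟩ := B.exists_coset_coeff k hx
  have hsummable : ∀ y y' τ, Summable fun a => c a y y' τ := fun y y' τ =>
    Summable.of_norm_bounded (summable_autFactor hs τ) fun a => hle a y y' τ
  have hE : ∀ y, B.discQuad y = 0 → ∀ τ z, B.eisensteinCls k y τ z =
      ∑ y', (1 / 2 * ∑' a, c a y y' τ) * B.theta y' τ z := by
    intro y hy τ z
    have h1 : ∀ a, B.fiberSum k 0 (Quotient.out y) a τ z = ∑ y', c a y y' τ * B.theta y' τ z := by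
      intro a
      have h2 := hsum a (Quotient.out y) (by rw [cls_out, hy]) τ z
      rwa [cls_out] at h2
    rw [eisensteinCls, eisenstein, poincare]
    simp only [h1]
    rw [Summable.tsum_finsetSum fun y' _ => (hsummable y y' τ).mul_right _, Finset.mul_sum]
    exact Finset.sum_congr rfl fun y' _ => by rw [tsum_mul_right, mul_assoc]
  have hbd := fun y => mdifferentiable_tsum_and_bounded hs (f := fun a => c a 0 y) (fun a => hhol a 0 y)
    fun a τ => hle a 0 y τ
  refine ⟨fun y τ => 1 / 2 * ∑' a, c a 0 y τ, fun y => ?_, fun y => ?_, hE 0 B.discQuad_zero,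
    fun τ z => ?_⟩
  · exact mdifferentiable_mul mdifferentiable_const (hbd y).1
  · obtain ⟨C, hC⟩ := (hbd y).2 1 1 one_pos
    refine ⟨1 / 2 * C, fun τ h1 h2 => ?_⟩
    rw [norm_mul]
    refine mul_le_mul ?_ (hC τ h1 h2) (norm_nonneg _) (by norm_num)
    norm_num
  · have hP : ∀ f : B.Disc → ℂ, ∑ l ∈ Finset.range (addOrderOf x), f (l • x) =
        ∑ y, B.isoMatrix x 0 y * f y := by
      intro f
      rw [sum_isoMatrix_mul, if_pos (B.discBil_zero_right x)]
      simp only [zero_add]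
    rw [Finset.sum_congr rfl fun l _ => hE (l • x) (B.discQuad_nsmul_of_isotropic hx l) τ z,
      Finset.sum_comm]
    refine Finset.sum_congr rfl fun y _ => ?_
    rw [← Finset.sum_mul]
    congr 1
    rw [hP fun y' => 1 / 2 * ∑' a, c a y' y τ]
    calc ∑ y', B.isoMatrix x 0 y' * (1 / 2 * ∑' a, c a y' y τ)
        = 1 / 2 * ∑' a, ∑ y', B.isoMatrix x 0 y' * c a y' y τ := by
          rw [Summable.tsum_finsetSum fun y' _ => (hsummable y' y τ).mul_left _, Finset.mul_sum]
          exact Finset.sum_congr rfl fun y' _ => by rw [tsum_mul_left]; ring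
      _ = 1 / 2 * ∑' a, ∑ y', c a 0 y' τ * B.isoMatrix x y' y := by simp only [hcomm]
      _ = _ := by
          rw [Summable.tsum_finsetSum fun y' _ => (hsummable 0 y' τ).mul_right _, Finset.mul_sum]
          exact Finset.sum_congr rfl fun y' _ => by rw [tsum_mul_right]; ring

end PosDefEvenForm

end LatticeJacobi

end

theorem propositionP {L : Type*} [AddCommGroup L] [Module.Free ℤ L] [Module.Finite ℤ L]
    (B : LatticeJacobi.PosDefEvenForm L) (k : ℤ) (hk : Even k)
    (hk' : (Module.finrank ℤ L : ℚ) / 2 + 2 < k) (x : B.Disc) (hx : B.discQuad x = 0) :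
    -- every series in the identity converges
    (∀ r : B.dual, B.discQuad (B.cls r) = 0 → B.EisensteinConverges k r) ∧
    (∀ (y : B.Disc) (τ : ℍ) (z : ℂ ⊗[ℤ] L),
      Summable fun r : {r : B.dual // B.cls r = y} => B.thetaTerm r τ z) ∧
    B.HasFourierExpansion (B.eisensteinCls k 0) (B.fourierCoeff (B.eisensteinCls k 0)) ∧
    (∀ (y : B.Disc) (τ : ℍ),
      Summable fun D : B.suppAt y => B.hTerm (B.eisensteinCls k 0) y D τ) ∧
    -- the identity
    (∀ (τ : ℍ) (z : ℂ ⊗[ℤ] L),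
      ∑ l ∈ Finset.range (addOrderOf x), B.eisensteinCls k (l • x) τ z =
        ∑ y : {y : B.Disc // B.discBil x y = 0},
          (∑ l ∈ Finset.range (addOrderOf x), B.hComp (B.eisensteinCls k 0) (y + l • x) τ) *
            B.theta y τ z) ∧
    -- the same identity for the Fourier coefficients
    (open Classical in
      B.HasFourierExpansion
        (fun τ z => ∑ l ∈ Finset.range (addOrderOf x), B.eisensteinCls k (l • x) τ z)
        (fun D y => if B.discBil x y = 0 then
          ∑ l ∈ Finset.range (addOrderOf x),
            B.fourierCoeff (B.eisensteinCls k 0) D (y + l • x) else 0)) := by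
  classical
  obtain ⟨h, hhol, hbd, hE, hEx⟩ := B.exists_theta_decomposition hk' hx
  have hT : ∀ y (τ : ℍ), h y (ModularGroup.T • τ) * LatticeJacobi.ratChar (B.discQuad y) = h y τ := by
    intro y τ
    have h1 := B.theta_linearIndependent τ
      (fun y => h y (ModularGroup.T • τ) * LatticeJacobi.ratChar (B.discQuad y) - h y τ) (fun z => by
        have h2 : B.eisensteinCls k 0 (ModularGroup.T • τ) z = B.eisensteinCls k 0 τ z :=
          B.eisenstein_T_smul k (by rw [B.cls_out, B.discQuad_zero]) τ z
        rw [hE, hE] at h2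
        simp only [B.theta_T_smul, ← mul_assoc] at h2
        simp only [sub_mul]
        rw [Finset.sum_sub_distrib, h2, sub_self]) y
    exact sub_eq_zero.1 h1
  choose C hC using fun y => B.exists_suppAt_expansion y (hhol y) (hbd y) (hT y)
  have hex : ∃ C, B.HasFourierExpansion (B.eisensteinCls k 0) C := by
    refine ⟨fun D y => C y D, ?_⟩
    rw [show B.eisensteinCls k 0 = fun τ z => _ from funext fun τ => funext fun z => hE τ z]
    exact B.hasFourierExpansion_of_theta hC
  have hF : B.HasFourierExpansion (B.eisensteinCls k 0)
      (B.fourierCoeff (B.eisensteinCls k 0)) := by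
    rw [LatticeJacobi.PosDefEvenForm.fourierCoeff, dif_pos hex]
    exact hex.choose_spec
  obtain ⟨hsum, hEF⟩ := B.theta_of_hasFourierExpansion hF
  -- the coefficients in `fourierCoeff` come from a choice, but they determine the `h_y`
  have hcomp : ∀ y τ, B.hComp (B.eisensteinCls k 0) y τ = h y τ := by
    intro y τ
    refine sub_eq_zero.1 (B.theta_linearIndependent τ
      (fun y => B.hComp (B.eisensteinCls k 0) y τ - h y τ) (fun z => ?_) y)
    simp only [sub_mul]
    rw [Finset.sum_sub_distrib, ← hE, sub_eq_zero]
    exact (hEF τ z).symm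
  have hEx' : ∀ τ z, ∑ l ∈ Finset.range (addOrderOf x), B.eisensteinCls k (l • x) τ z =
      ∑ y, (if B.discBil x y = 0 then ∑ l ∈ Finset.range (addOrderOf x),
        B.hComp (B.eisensteinCls k 0) (y + l • x) τ else 0) * B.theta y τ z := by
    intro τ z
    rw [hEx]
    refine Finset.sum_congr rfl fun y _ => ?_
    rw [B.sum_mul_isoMatrix hx y fun y' => h y' τ]
    simp only [hcomp]
    split_ifs
    · rw [LatticeJacobi.sum_range_sub_nsmul x y fun y' => h y' τ]
    · rfl
  refine ⟨fun r hr => B.eisensteinConverges hk' hr, fun y τ z => (B.hasSum_theta y τ z).summable,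
    hF, hsum, fun τ z => ?_, ?_⟩
  · rw [hEx']
    simp only [ite_mul, zero_mul]
    rw [← Finset.sum_filter]
    exact Finset.sum_subtype _ (fun y => by simp) fun y =>
      (∑ l ∈ Finset.range (addOrderOf x), B.hComp (B.eisensteinCls k 0) (y + l • x) τ) *
        B.theta y τ z
  · rw [show (fun τ z => ∑ l ∈ Finset.range (addOrderOf x), B.eisensteinCls k (l • x) τ z) =
      fun τ z => _ from funext fun τ => funext fun z => hEx' τ z]
    refine B.hasFourierExpansion_of_theta (h := fun y τ => if B.discBil x y = 0 then
      ∑ l ∈ Finset.range (addOrderOf x), B.hComp (B.eisensteinCls k 0) (y + l • x) τ else 0)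
      fun y τ => ?_
    by_cases hy : B.discBil x y = 0
    · simp only [if_pos hy, Finset.sum_mul]
      refine hasSum_sum fun l _ => ?_
      have hset : B.suppAt (y + l • x) = B.suppAt y := by
        simp only [LatticeJacobi.PosDefEvenForm.suppAt, B.discQuad_add_nsmul hx hy l]
      have h1 := (hsum (y + l • x) τ).hasSum
      rw [← hset]
      exact h1
    · simpa only [if_neg hy, zero_mul] using hasSum_zero
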